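/- Identify $\mathbb R^2$ with $\mathbb C$ and write $X=Re^{i\theta}$. **The vortex.** Let $0<r_1<r_2$, $0<\varepsilon<\frac13\min\{r_1,r_2-r_1\}$, let $c=(r_2/r_1)^2-1$, and let $\eta\in C_c^\infty(-1,1)$ with $\int\eta=1$, $\eta^\varepsilon(x)=\varepsilon^{-1}\eta(x/\varepsilon)$. Put $v_1(r)=\frac{cr}{2}$, $v_2(r)=\frac r2\big((r_2/r)^2-1\big)$, $\chi=1_{[r_1,r_2)}*\eta^\varepsilon$, and let $$\bar V_\theta(r)=\begin{cases} v_1+(v_2-v_1)\chi, & |r-r_1|<\varepsilon,\\ v_2\,\chi, & |r-r_2|<\varepsilon,\\ v_11_{[0,r_1]}+v_21_{(r_1,r_2]}, & \text{otherwise,}\end{cases}\qquad \bar W(r)=\frac1r\,\partial_r\big(r\bar V_\theta(r)\big)$$ (with $\bar W(0)=c$ by continuity). Let $\bar\Omega(X)=\bar W(|X|)\in C_c^\infty(\mathbb R^2)$, a vortex with zero mean, let $\bar V=\bar V_\theta e_\theta$ be its velocity, and for $b>0$ let $\bar V_b=\bar V-bX$, so that $\mathrm{div}\,\bar V_b=-2b$.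 **The operator.** Let $n\ge2$ and $0<a,b\le1$. Let $L^2_n$ be the space of complex-valued $\Omega\in L^2(\mathbb R^2)$ with $\Omega(e^{2\pi i/n}X)=\Omega(X)$ and zero mean (in the sense $\lim_{R\to\infty}\int_{|X|<R}\Omega=0$), and for $k\in\mathbb Z$ let $U_k=\{\Omega\in L^2:\Omega(X)=\Omega_k(R)e^{ik\theta}\}$. On the domain $D(L_b)=\{\Omega\in L^2_n:\mathrm{div}(\bar V_b\Omega)\in L^2_n\}$ (distributional divergence) let $$L_b\Omega=ab\,\Omega-\bar V_b\cdot\nabla\Omega-V\cdot\nabla\bar\Omega,\qquad \bar V_b\cdot\nabla\Omega=\mathrm{div}(\bar V_b\Omega)+2b\,\Omega,$$ where $V=\nabla^\perp\Delta^{-1}\Omega$ is given by the Biot–Savart law, understood as $$V(X)=\lim_{\rho\to\infty}\frac1{2\pi}\int_{|Y|<\rho}\frac{(X-Y)^\perp}{|X-Y|^2}\,\Omega(Y)\,dY\quad\text{for a.e. }X,\qquad (x_1,x_2)^\perp=(-x_2,x_1).$$ **Hölder classes.** For $\gamma>0$ write $\gamma=k+\alpha$ with $k\in\mathbb N_0$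 and $0<\alpha\le1$. Then $C^\gamma(\mathbb R^2)$ is the space of $C^k$ functions whose derivatives up to order $k$ are bounded and whose derivatives of order $k$ are $\alpha$-Hölder continuous (so $C^\gamma=C^{\gamma-1,1}$ when $\gamma$ is an integer); $C_c^\gamma$ denotes its compactly supported elements. **Proposition.** Let $\lambda\in\mathbb C$ with $\mathrm{Re}\,\lambda>3b$, let $j\in\mathbb Z\setminus\{0\}$, and let $W\in\mathrm{Ker}(L_b-\lambda)\cap U_{jn}$. Then $\gamma:=\frac{\mathrm{Re}\,\lambda}{b}-a\ge2$ and, after modification on a null set, $$W\in C^\infty(\mathbb R^2\setminus\{0\})\cap C_c^\gamma(\mathbb R^2).$$ -/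

import Mathlib

open MeasureTheory Filter Topology
open scoped ContDiff

noncomputable section

/-! The plane is identified with `ℂ`, `X = R e^{iθ}`; derivatives are real derivatives. -/

/-- Parameters of the regularized vortex: two radii, a regularization length, a mollifier. -/
structure VortexData where
  r₁ : ℝ
  r₂ : ℝ
  ε : ℝ
  η : ℝ → ℝ

namespace VortexData

/-- The constraints `0 < r₁ < r₂`, `0 < ε < min {r₁, r₂ - r₁} / 3`, `η ∈ C_c^∞(-1,1)`, `∫ η = 1`. -/
structure Admissible (P : VortexData) : Prop where
  r₁_pos : 0 < P.r₁
  r₁_lt_r₂ : P.r₁ < P.r₂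
  ε_pos : 0 < P.ε
  ε_lt : P.ε < min P.r₁ (P.r₂ - P.r₁) / 3
  η_smooth : ContDiff ℝ ∞ P.η
  η_supp : tsupport P.η ⊆ Set.Ioo (-1) 1
  η_integral : ∫ x, P.η x = 1

variable (P : VortexData)

/-- The constant `c` with `(1 + c) (r₁ / r₂)² = 1` (zero mean condition). -/
def c : ℝ := (P.r₂ / P.r₁) ^ 2 - 1

/-- Angular velocity on the inner disc. -/
def v₁ (r : ℝ) : ℝ := P.c * r / 2

/-- Angular velocity on the annulus. -/
def v₂ (r : ℝ) : ℝ := r / 2 * ((P.r₂ / r) ^ 2 - 1)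

/-- Angular velocity of the piecewise constant vortex `c 1_{[0,r₁)} - 1_{[r₁,r₂)}`. -/
def vSharp (r : ℝ) : ℝ :=
  if r ≤ P.r₁ then P.v₁ r else if r ≤ P.r₂ then P.v₂ r else 0

/-- The mollified indicator `1_{[r₁,r₂)} * η^ε`, where `η^ε(x) = ε⁻¹ η(x/ε)`. -/
def cutoff (r : ℝ) : ℝ := ∫ s in P.r₁..P.r₂, P.ε⁻¹ * P.η ((r - s) / P.ε)

/-- The regularized angular velocity profile `V̄_θ`. -/
def vθ (r : ℝ) : ℝ :=
  if |r - P.r₁| < P.ε then P.v₁ r + (P.v₂ r - P.v₁ r) * P.cutoff r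
  else if |r - P.r₂| < P.ε then P.v₂ r * P.cutoff r
  else P.vSharp r

/-- The regularized vorticity profile `r⁻¹ ∂_r (r V̄_θ)`. It is identically `c` near `r = 0`,
and this value is assigned at `r = 0`, where the formula is not meaningful. -/
def w (r : ℝ) : ℝ := if r = 0 then P.c else deriv (fun s => s * P.vθ s) r / r

/-- The vortex `Ω̄(X) = W̄(|X|)`. -/
def Ωbar (X : ℂ) : ℝ := P.w ‖X‖

/-- Its velocity `V̄(X) = V̄_θ(|X|) e_θ`, with `e_θ = i X / |X|`. -/
def Vbar (X : ℂ) : ℂ := (P.vθ ‖X‖ : ℂ) * (Complex.I * X / (‖X‖ : ℂ))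

/-- The vector field `V̄_b = V̄ - b X`. -/
def Vb (b : ℝ) (X : ℂ) : ℂ := P.Vbar X - (b : ℂ) * X

end VortexData

/-- `L²_n`: square integrable, `n`-fold symmetric, with zero mean. The mean of an `L²` function is
the improper integral `lim_{R → ∞} ∫_{|X| < R} Ω = 2π ∫_0^∞ Ω_0(R) R dR`. -/
def L2n (n : ℕ) : Set (ℂ → ℂ) :=
  {Ω | MemLp Ω 2 volume ∧
    (∀ᵐ X : ℂ, Ω X = Ω (Complex.exp (2 * Real.pi * Complex.I / n) * X)) ∧
    Tendsto (fun R : ℝ => ∫ X in Metric.ball (0 : ℂ) R, Ω X) atTop (𝓝 0)}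

/-- `U_k`: the functions in `L²` of the form `Ω_k(R) e^{ikθ}`. -/
def U (k : ℤ) : Set (ℂ → ℂ) :=
  {Ω | MemLp Ω 2 volume ∧
    ∃ g : ℝ → ℂ, ∀ᵐ X : ℂ, Ω X = g ‖X‖ * (X / (‖X‖ : ℂ)) ^ k}

/-- The Biot-Savart integral `(2π)⁻¹ ∫_{|Y| < ρ} (X - Y)^⊥ / |X - Y|² Ω(Y) dY` of the part of a
(complex valued) vorticity in a disc, with `(x₁, x₂)^⊥ = (-x₂, x₁)`. -/
def biotSavartTrunc (Ω : ℂ → ℂ) (ρ : ℝ) (X : ℂ) : ℂ × ℂ :=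
  (∫ Y in Metric.ball (0 : ℂ) ρ, ((-(X - Y).im / (2 * Real.pi * ‖X - Y‖ ^ 2) : ℝ) : ℂ) * Ω Y,
   ∫ Y in Metric.ball (0 : ℂ) ρ, (((X - Y).re / (2 * Real.pi * ‖X - Y‖ ^ 2) : ℝ) : ℂ) * Ω Y)

/-- The velocity `V = ∇^⊥ Δ⁻¹ Ω`, as the limit of the velocities of the truncations of `Ω`. For `Ω`
in `L²_n`, `n ≥ 2`, the integral over the plane need not converge absolutely, but the limit exists
almost everywhere (by the symmetry of `Ω`) and is the extension of the Biot-Savart operator by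
density. -/
def velocity (Ω : ℂ → ℂ) (X : ℂ) : ℂ × ℂ :=
  limUnder atTop (fun ρ : ℝ => biotSavartTrunc Ω ρ X)

/-- `D` is the distributional divergence of the vector field `Ω F`. -/
def IsWeakDiv (F : ℂ → ℂ) (Ω D : ℂ → ℂ) : Prop :=
  ∀ φ : ℂ → ℂ, ContDiff ℝ ∞ φ → HasCompactSupport φ →
    ∫ X, Ω X * fderiv ℝ φ X (F X) = -∫ X, D X * φ X

namespace VortexData

variable (P : VortexData)

/-- `K Ω = -V · ∇Ω̄` with `V = ∇^⊥ Δ⁻¹ Ω`. -/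
def K (Ω : ℂ → ℂ) (X : ℂ) : ℂ :=
  -((velocity Ω X).1 * ((fderiv ℝ P.Ωbar X 1 : ℝ) : ℂ) +
    (velocity Ω X).2 * ((fderiv ℝ P.Ωbar X Complex.I : ℝ) : ℂ))

/-- The graph of `L_b = ab + T_b + K` on `L²_n`: `Ω` is in the domain
`{Ω ∈ L²_n : div (V̄_b Ω) ∈ L²_n}` and `L_b Ω = F` almost everywhere. Since `div V̄_b = -2b`, the
transport operator is `T_b Ω = -V̄_b · ∇Ω = -(div (V̄_b Ω) + 2 b Ω)`. -/
def LbGraph (a b : ℝ) (n : ℕ) (Ω F : ℂ → ℂ) : Prop :=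
  Ω ∈ L2n n ∧ ∃ D ∈ L2n n, IsWeakDiv (P.Vb b) Ω D ∧
    ∀ᵐ X : ℂ, (a * b : ℂ) * Ω X + -(D X + 2 * (b : ℂ) * Ω X) + P.K Ω X = F X

/-- `Ker (L_b - lam)`. -/
def kerLb (a b : ℝ) (n : ℕ) (lam : ℂ) : Set (ℂ → ℂ) :=
  {W | P.LbGraph a b n W (fun X => lam * W X)}

end VortexData

/-- The Hölder class `C^γ(ℝ²)`, `γ > 0`: writing `γ = k + α` with `k ∈ ℕ` and `0 < α ≤ 1`, the
derivatives up to order `k` exist, are continuous and bounded, and those of order `k` are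
`α`-Hölder continuous. -/
def IsHolderClass (γ : ℝ) (f : ℂ → ℂ) : Prop :=
  ∃ (k : ℕ) (α : ℝ), 0 < α ∧ α ≤ 1 ∧ γ = k + α ∧ ContDiff ℝ k f ∧
    (∀ i ≤ k, ∃ C : ℝ, ∀ x, ‖iteratedFDeriv ℝ i f x‖ ≤ C) ∧
    ∃ C : ℝ, ∀ x y, ‖iteratedFDeriv ℝ k f x - iteratedFDeriv ℝ k f y‖ ≤ C * ‖x - y‖ ^ α

end

/-! Write `W = g(R) e^{ikθ}` with `k = jn`, so that `m = |k| ≥ 2`, and let `γ = re lam / b - a`.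
Since `Ω̄` is radial, the nonlocal term involves only the radial component of the velocity. Fourier
analysis of the Cauchy kernel on circles shows that this component is a multiple of `h(R)/R` times
the phase, where `h(R) = R^{-m} ∫_0^R s^{m+1} g + R^m ∫_R^∞ s^{1-m} g` (`velocity_radial`); the
outer integral converges for `g ∈ L²(s ds)` because `m ≥ 2`.

The eigenvalue equation thus becomes a first order equation on `(0, ∞)`. With an integrating factor
`μ` it reads `(s² μ g)' = q h` in the weak sense, where `q` is a smooth multiple of the derivative
of `W̄` (`weak_radial`). As `h` is at least as regular as `g`, bootstrapping makes `g` smooth away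
from the origin (`exists_smooth_of_weak_radial`).

Near the origin and far out `W̄` is constant, so `s² μ g` is constant on each of these two regions,
where `|s² μ|` is a multiple of `s^{-γ}`. Far out, a nonzero constant would contradict square
integrability, whence the compact support. Near the origin, `W` is positively homogeneous of a
complex degree `z` with `re z = γ`, the rigid rotation of the core contributing only to `im z`
(`exists_profile`).

Such a function is of class `C^γ`: each derivative lowers the degree by one and vanishes at the
origin, until the real part of the degree lies in `(0, 1]` and Hölder continuity is elementary
(`PunctHomog.contDiff_holder`). The bound on `γ` is arithmetic: `re lam / b > 3` and `a ≤ 1`. -/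

section PunctHomog

/-! ### Functions homogeneous near the origin and their Hölder regularity. -/

variable {G : Type} [NormedAddCommGroup G] [NormedSpace ℝ G] [NormedSpace ℂ G] [IsScalarTower ℝ ℂ G]

/-- Compactly supported functions, smooth off the origin and positively homogeneous of complex
degree `z` near the origin. -/
structure PunctHomog (z : ℂ) (F : ℂ → G) : Prop where
  smooth : ContDiffOn ℝ ∞ F {0}ᶜ
  compact : HasCompactSupport F
  homog : ∃ r₀ : ℝ, 0 < r₀ ∧ ∀ X : ℂ, X ≠ 0 → ‖X‖ < r₀ → ∀ t : ℝ, 0 < t → t ≤ 1 →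
    F (t • X) = (t : ℂ) ^ z • F X

set_option linter.unusedSectionVars false in
-- Near the origin `‖F X‖ ‖X‖^{-re z}` is constant along rays, so it is controlled by its values on
-- the part of the support outside a small ball, which is compact.
theorem PunctHomog.bound {z : ℂ} {F : ℂ → G} (h : PunctHomog z F) :
    ∃ C : ℝ, 0 ≤ C ∧ ∀ X : ℂ, X ≠ 0 → ‖F X‖ ≤ C * ‖X‖ ^ z.re := by
  obtain ⟨r₀, hr₀, hh⟩ := h.homog
  set r := r₀ / 2 with hr
  have hrpos : 0 < r := by positivity
  set q : ℂ → ℝ := fun X => ‖F X‖ * ‖X‖ ^ (-z.re) with hq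
  have hqc : ContinuousOn q {0}ᶜ := by
    apply ContinuousOn.mul h.smooth.continuousOn.norm
    apply ContinuousOn.rpow_const continuous_norm.continuousOn
    intro x hx
    left
    simpa using hx
  set K : Set ℂ := tsupport F ∩ (Metric.ball 0 r)ᶜ
  have hK : IsCompact K := IsCompact.inter_right h.compact Metric.isOpen_ball.isClosed_compl
  have hK0 : K ⊆ {0}ᶜ := by
    rintro x ⟨-, hx⟩ hx0
    rw [Set.mem_singleton_iff] at hx0
    apply hx
    simp [hx0, hrpos]
  obtain ⟨M, hM⟩ := (hK.bddAbove_image (hqc.mono hK0))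
  have hfar : ∀ X : ℂ, r ≤ ‖X‖ → q X ≤ max M 0 := by
    intro X hX
    by_cases hXs : X ∈ tsupport F
    · exact le_max_of_le_left (hM ⟨X, ⟨hXs, by simpa using hX⟩, rfl⟩)
    · simp [hq, image_eq_zero_of_notMem_tsupport hXs]
  have hall : ∀ X : ℂ, X ≠ 0 → q X ≤ max M 0 := by
    intro X hX
    rcases le_or_gt r ‖X‖ with hX' | hX'
    · exact hfar X hX'
    have hXn : 0 < ‖X‖ := norm_pos_iff.mpr hX
    set t : ℝ := ‖X‖ / r
    have ht : 0 < t := by positivity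
    have ht1 : t ≤ 1 := by rw [div_le_one hrpos]; exact hX'.le
    set Y : ℂ := t⁻¹ • X with hY
    have hYn : ‖Y‖ = r := by
      rw [hY, norm_smul, norm_inv, Real.norm_of_nonneg ht.le]
      simp only [t]; field_simp
    have hY0 : Y ≠ 0 := by rw [← norm_pos_iff, hYn]; exact hrpos
    have hXY : X = t • Y := by rw [hY, smul_smul, mul_inv_cancel₀ ht.ne', one_smul]
    have h1 := hh Y hY0 (by rw [hYn]; linarith) t ht ht1
    rw [← hXY] at h1
    have : q X = q Y := by
      simp only [hq]
      rw [h1, norm_smul, Complex.norm_cpow_eq_rpow_re_of_pos ht, hXY, norm_smul,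
        Real.norm_of_nonneg ht.le, Real.mul_rpow ht.le (norm_nonneg _), Real.rpow_neg ht.le]
      have := (Real.rpow_pos_of_pos ht z.re).ne'
      field_simp
    rw [this]
    exact hfar Y hYn.ge
  refine ⟨max M 0, le_max_right _ _, fun X hX => ?_⟩
  have := hall X hX
  have hXn : 0 < ‖X‖ := norm_pos_iff.mpr hX
  simp only [hq] at this
  rwa [Real.rpow_neg hXn.le, ← div_eq_mul_inv, div_le_iff₀ (Real.rpow_pos_of_pos hXn _)] at this

/-- Differentiating `F (tY) = t^z F Y` in `Y` gives `t F'(tX) = t^z F'(X)`. -/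
theorem PunctHomog.fderiv {z : ℂ} {F : ℂ → G} (h : PunctHomog z F) :
    PunctHomog (z - 1) (fderiv ℝ F) := by
  refine ⟨?_, h.compact.fderiv ℝ, ?_⟩
  · exact h.smooth.fderiv_of_isOpen isOpen_compl_singleton (by simp)
  · obtain ⟨r₀, hr₀, hh⟩ := h.homog
    refine ⟨r₀, hr₀, fun X hX hXr t ht ht1 => ?_⟩
    have hev : (fun Y : ℂ => F (t • Y)) =ᶠ[𝓝 X] fun Y => ((t : ℂ) ^ z) • F Y := by
      have h1 : ∀ᶠ Y : ℂ in 𝓝 X, Y ≠ 0 := isOpen_ne.mem_nhds hX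
      have h2 : ∀ᶠ Y : ℂ in 𝓝 X, ‖Y‖ < r₀ :=
        (isOpen_lt continuous_norm continuous_const).mem_nhds hXr
      filter_upwards [h1, h2] with Y hY1 hY2 using hh Y hY1 hY2 t ht ht1
    have hd := hev.fderiv_eq (𝕜 := ℝ)
    have hdiff : DifferentiableAt ℝ F X :=
      ((h.smooth X hX).contDiffAt (isOpen_compl_singleton.mem_nhds hX)).differentiableAt (by simp)
    rw [fderiv_comp_smul, fderiv_fun_const_smul hdiff] at hd
    have htc : (t : ℂ) ≠ 0 := by exact_mod_cast ht.ne'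
    rw [Complex.cpow_sub _ _ htc, Complex.cpow_one]
    have h3 : (t⁻¹ : ℝ) • (t • _root_.fderiv ℝ F (t • X)) = (t⁻¹ : ℝ) • ((t : ℂ) ^ z • _root_.fderiv ℝ F X) := by
      rw [hd]
    rw [smul_smul, inv_mul_cancel₀ ht.ne', one_smul] at h3
    rw [h3]
    ext v
    simp only [_root_.smul_apply]
    rw [← smul_assoc, Complex.real_smul]
    congr 1
    push_cast
    field_simp

set_option linter.unusedSectionVars false in
-- Homogeneity does not constrain the value at the origin, hence the hypothesis `F 0 = 0`; then `F =
-- O(‖X‖^{re z}) = o(‖X‖)`. The vanishing derivative supplies the same hypothesis for `fderiv ℝ F`.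
theorem PunctHomog.hasFDerivAt_zero {z : ℂ} {F : ℂ → G} (h : PunctHomog z F) (h0 : F 0 = 0)
    (hz : 1 < z.re) : HasFDerivAt F (0 : ℂ →L[ℝ] G) 0 := by
  obtain ⟨C, hC, hb⟩ := h.bound
  rw [hasFDerivAt_iff_isLittleO_nhds_zero]
  simp only [zero_add, h0, sub_zero, zero_apply]
  have h1 : (fun X : ℂ => F X) =O[𝓝 0] fun X : ℂ => ‖X‖ * ‖X‖ ^ (z.re - 1) := by
    apply Asymptotics.IsBigO.of_bound C
    refine Eventually.of_forall fun X => ?_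
    rcases eq_or_ne X 0 with rfl | hX
    · simp [h0]
    have hXn : 0 < ‖X‖ := norm_pos_iff.mpr hX
    refine (hb X hX).trans_eq ?_
    rw [Real.norm_of_nonneg (by positivity)]
    congr 1
    rw [Real.rpow_sub_one hXn.ne']
    field_simp
  refine h1.trans_isLittleO ?_
  have h2 : (fun X : ℂ => ‖X‖ ^ (z.re - 1)) =o[𝓝 0] fun _ : ℂ => (1 : ℝ) := by
    rw [Asymptotics.isLittleO_one_iff]
    have hc : ContinuousAt (fun X : ℂ => ‖X‖ ^ (z.re - 1)) 0 :=
      continuous_norm.continuousAt.rpow_const (Or.inr (by linarith))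
    have := hc.tendsto
    simpa [Real.zero_rpow (by linarith : z.re - 1 ≠ 0)] using this
  have h3 := (Asymptotics.isBigO_refl (fun X : ℂ => ‖X‖) (𝓝 0)).mul_isLittleO h2
  simp only [mul_one] at h3
  exact h3.of_norm_right

/-- Functions homogeneous of degree `z` with `0 < re z ≤ 1` are Hölder continuous. -/
theorem PunctHomog.holder {z : ℂ} {F : ℂ → G} (h : PunctHomog z F) (h0 : F 0 = 0)
    (hz0 : 0 < z.re) (hz1 : z.re ≤ 1) :
    ∃ C : ℝ, ∀ x y, ‖F x - F y‖ ≤ C * ‖x - y‖ ^ z.re := by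
  obtain ⟨C, hC, hb⟩ := h.bound
  obtain ⟨D, hD, hd⟩ := h.fderiv.bound
  have hb' : ∀ X, ‖F X‖ ≤ C * ‖X‖ ^ z.re := by
    intro X
    rcases eq_or_ne X 0 with rfl | hX
    · rw [h0, norm_zero]; positivity
    · exact hb X hX
  have main : ∀ x y : ℂ, ‖y‖ ≤ ‖x‖ → ‖F x - F y‖ ≤ (C * 2 ^ z.re + C * 2 ^ z.re + D) * ‖x - y‖ ^ z.re := by
    intro x y hyx
    have hp : 0 ≤ ‖x - y‖ ^ z.re := by positivity
    -- If the distance is comparable to `‖x‖`, the size bound on `F` suffices. Otherwise the ball of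
    -- radius `‖x - y‖` about `x` stays at distance at least `‖x - y‖` from the origin, and the mean
    -- value inequality applies with a derivative of degree `re z - 1 ≤ 0`.
    rcases le_or_gt ‖x‖ (2 * ‖x - y‖) with hc | hc
    · have e1 : ‖x‖ ^ z.re ≤ 2 ^ z.re * ‖x - y‖ ^ z.re := by
        rw [← Real.mul_rpow (by norm_num) (norm_nonneg _)]
        exact Real.rpow_le_rpow (norm_nonneg _) hc hz0.le
      have e2 : ‖y‖ ^ z.re ≤ 2 ^ z.re * ‖x - y‖ ^ z.re :=
        (Real.rpow_le_rpow (norm_nonneg _) hyx hz0.le).trans e1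
      calc ‖F x - F y‖ ≤ ‖F x‖ + ‖F y‖ := norm_sub_le _ _
        _ ≤ C * ‖x‖ ^ z.re + C * ‖y‖ ^ z.re := add_le_add (hb' x) (hb' y)
        _ ≤ C * (2 ^ z.re * ‖x - y‖ ^ z.re) + C * (2 ^ z.re * ‖x - y‖ ^ z.re) := by gcongr
        _ ≤ _ := by nlinarith [mul_nonneg hD hp]
    · rcases eq_or_ne x y with rfl | hxy
      · simp; positivity
      have hd0 : 0 < ‖x - y‖ := norm_pos_iff.mpr (sub_ne_zero.mpr hxy)
      have hB : ∀ u ∈ Metric.closedBall x ‖x - y‖, ‖x - y‖ ≤ ‖u‖ := by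
        intro u hu
        rw [mem_closedBall_iff_norm] at hu
        have : ‖x‖ ≤ ‖u‖ + ‖x - u‖ := by simpa using norm_add_le u (x - u)
        rw [norm_sub_rev] at this
        linarith
      have hB0 : ∀ u ∈ Metric.closedBall x ‖x - y‖, u ≠ 0 := by
        intro u hu hu0
        have := hB u hu
        rw [hu0, norm_zero] at this
        linarith
      have hmv := (convex_closedBall x ‖x - y‖).norm_image_sub_le_of_norm_fderiv_le (𝕜 := ℝ) (f := F)
        (C := D * ‖x - y‖ ^ (z.re - 1)) (fun u hu => ?_) (fun u hu => ?_)
        (x := y) (y := x) (by rw [mem_closedBall_iff_norm, norm_sub_rev]) (by simp)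
      · refine hmv.trans ?_
        have : D * ‖x - y‖ ^ (z.re - 1) * ‖x - y‖ = D * ‖x - y‖ ^ z.re := by
          rw [Real.rpow_sub_one hd0.ne']; field_simp
        rw [this]
        have : 0 ≤ C * 2 ^ z.re := by positivity
        nlinarith [mul_nonneg this hp]
      · have hu0 := hB0 u hu
        exact ((h.smooth u hu0).contDiffAt (isOpen_compl_singleton.mem_nhds hu0)).differentiableAt
          (by simp)
      · refine (hd u (hB0 u hu)).trans ?_
        gcongr
        simp only [Complex.sub_re, Complex.one_re]
        exact Real.rpow_le_rpow_of_nonpos hd0 (hB u hu) (by linarith)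
  refine ⟨C * 2 ^ z.re + C * 2 ^ z.re + D, fun x y => ?_⟩
  rcases le_total ‖y‖ ‖x‖ with hyx | hyx
  · exact main x y hyx
  · rw [norm_sub_rev, norm_sub_rev x y]; exact main y x hyx

end PunctHomog

/-- Induction by passing to the derivative. The target space varies because `fderiv ℝ F` takes
values in `ℂ →L[ℝ] G`; its complex structure is what lets `t^z` act. -/
theorem PunctHomog.contDiff_holder (K : ℕ) : ∀ {G : Type} [NormedAddCommGroup G] [NormedSpace ℝ G]
    [NormedSpace ℂ G] [IsScalarTower ℝ ℂ G] {z : ℂ} {F : ℂ → G}, PunctHomog z F → F 0 = 0 →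
    ∀ α : ℝ, 0 < α → α ≤ 1 → z.re = K + α →
    ContDiff ℝ K F ∧ ∃ C : ℝ, ∀ x y,
      ‖iteratedFDeriv ℝ K F x - iteratedFDeriv ℝ K F y‖ ≤ C * ‖x - y‖ ^ α := by
  induction K with
  | zero =>
    intro G _ _ _ _ z F h h0 α hα hα1 hz
    simp only [Nat.cast_zero, zero_add] at hz
    obtain ⟨C, hC⟩ := h.holder h0 (by rw [hz]; exact hα) (by rw [hz]; exact hα1)
    rw [hz] at hC
    refine ⟨?_, C, fun x y => ?_⟩
    · rw [Nat.cast_zero, contDiff_zero]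
      rw [continuous_iff_continuousAt]
      intro x
      rw [ContinuousAt, tendsto_iff_norm_sub_tendsto_zero]
      have : Tendsto (fun y => C * ‖y - x‖ ^ α) (𝓝 x) (𝓝 0) := by
        have hc : ContinuousAt (fun y => C * ‖y - x‖ ^ α) x := by
          apply ContinuousAt.mul continuousAt_const
          exact ContinuousAt.rpow_const (by fun_prop) (Or.inr hα.le)
        have := hc.tendsto
        simpa [Real.zero_rpow hα.ne'] using this
      exact squeeze_zero (fun _ => norm_nonneg _) (fun y => hC y x) this
    · rw [iteratedFDeriv_zero_eq_comp]
      simp only [Function.comp_apply, ← map_sub, LinearIsometryEquiv.norm_map]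
      exact hC x y
  | succ K ih =>
    intro G _ _ _ _ z F h h0 α hα hα1 hz
    push_cast at hz
    have hz1 : 1 < z.re := by
      rw [hz]; have : (0 : ℝ) ≤ K := Nat.cast_nonneg K
      linarith
    have hd0 := h.hasFDerivAt_zero h0 hz1
    obtain ⟨h1, C, hC⟩ := ih h.fderiv hd0.fderiv α hα hα1 (by
      simp only [Complex.sub_re, Complex.one_re]; linarith)
    refine ⟨?_, C, fun x y => ?_⟩
    · rw [Nat.cast_succ, contDiff_succ_iff_fderiv]
      refine ⟨fun x => ?_, by simp, h1⟩
      rcases eq_or_ne x 0 with rfl | hx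
      · exact hd0.differentiableAt
      · exact ((h.smooth x hx).contDiffAt (isOpen_compl_singleton.mem_nhds hx)).differentiableAt
          (by simp)
    · have e : ∀ u, iteratedFDeriv ℝ (K + 1) F u = (continuousMultilinearCurryRightEquiv' ℝ K ℂ G).symm
          (iteratedFDeriv ℝ K (_root_.fderiv ℝ F) u) := fun u => by
        rw [iteratedFDeriv_succ_eq_comp_right]; rfl
      have e' := (continuousMultilinearCurryRightEquiv' ℝ K ℂ G).symm.dist_map
        (iteratedFDeriv ℝ K (_root_.fderiv ℝ F) x) (iteratedFDeriv ℝ K (_root_.fderiv ℝ F) y)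
      rw [dist_eq_norm, dist_eq_norm] at e'
      rw [e, e]
      exact e'.trans_le (hC x y)

theorem PunctHomog.isHolderClass {z : ℂ} {F : ℂ → ℂ} (h : PunctHomog z F) (h0 : F 0 = 0)
    (hz : 0 < z.re) : IsHolderClass z.re F := by
  have hc : 0 < ⌈z.re⌉₊ := Nat.ceil_pos.mpr hz
  -- The ceiling minus one, not the floor: an integer degree must give `α = 1` rather than `α = 0`.
  obtain ⟨k, hk⟩ : ∃ k : ℕ, ⌈z.re⌉₊ = k + 1 := ⟨⌈z.re⌉₊ - 1, by omega⟩
  have h1 : z.re ≤ k + 1 := by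
    have := Nat.le_ceil z.re
    rw [hk] at this; exact_mod_cast this
  have h2 : (k : ℝ) < z.re := Nat.lt_ceil.mp (by omega)
  obtain ⟨hcd, hH⟩ := h.contDiff_holder k h0 (z.re - k) (by linarith) (by linarith) (by ring)
  refine ⟨k, z.re - k, by linarith, by linarith, by ring, hcd, fun i hi => ?_, hH⟩
  have hcont : Continuous (iteratedFDeriv ℝ i F) := hcd.continuous_iteratedFDeriv (by exact_mod_cast hi)
  exact (h.compact.iteratedFDeriv i).exists_bound_of_continuous hcont

/-! ### Radial functions on the plane -/

theorem integral_radial (f : ℝ → ℂ) :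
    ∫ X : ℂ, f ‖X‖ = 2 * Real.pi * ∫ s in Set.Ioi (0 : ℝ), s * f s := by
  rw [integral_fun_norm_addHaar]
  simp [Measure.real, mul_assoc]

theorem integrable_radial_iff {F : Type*} [NormedAddCommGroup F] [NormedSpace ℝ F] {f : ℝ → F} :
    Integrable (fun X : ℂ => f ‖X‖) ↔ IntegrableOn (fun s : ℝ => s • f s) (Set.Ioi 0) := by
  rw [integrable_fun_norm_addHaar]
  simp

theorem integrableOn_ball_radial_iff {F : Type*} [NormedAddCommGroup F] [NormedSpace ℝ F]
    {f : ℝ → F} {r : ℝ} : IntegrableOn (fun X : ℂ => f ‖X‖) (Metric.ball 0 r) ↔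
      IntegrableOn (fun s : ℝ => s • f s) (Set.Ioo 0 r) := by
  rw [integrableOn_fun_norm_addHaar]
  simp

theorem ae_radial {u v : ℝ → ℂ} (h : ∀ᵐ s ∂volume.restrict (Set.Ioi 0), u s = v s) :
    ∀ᵐ X : ℂ, u ‖X‖ = v ‖X‖ := by
  have h1 : (fun s : ℝ => s • ‖u s - v s‖) =ᵐ[volume.restrict (Set.Ioi 0)] fun _ => 0 := by
    filter_upwards [h] with s hs
    simp [hs]
  have h2 : Integrable (fun X : ℂ => ‖u ‖X‖ - v ‖X‖‖) :=
    integrable_radial_iff (f := fun s => ‖u s - v s‖).2 ((integrable_zero _ _ _).congr h1.symm)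
  have h3 : ∫ X : ℂ, ‖u ‖X‖ - v ‖X‖‖ = 0 := by
    rw [integral_fun_norm_addHaar volume (fun s => ‖u s - v s‖)]
    simp only [Complex.finrank_real_complex, Nat.add_one_sub_one, pow_one]
    rw [integral_congr_ae h1]
    simp
  rw [integral_eq_zero_iff_of_nonneg (fun _ => norm_nonneg _) h2] at h3
  filter_upwards [h3] with X hX
  simpa [sub_eq_zero] using hX

/-- `g` is the radial profile of a square integrable function on the plane. -/
structure RadialL2 (g : ℝ → ℂ) : Prop where
  aesm : AEStronglyMeasurable g (volume.restrict (Set.Ioi 0))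
  sq : IntegrableOn (fun s : ℝ => s * ‖g s‖ ^ 2) (Set.Ioi 0)

theorem norm_unit_zpow {X : ℂ} (hX : X ≠ 0) (k : ℤ) : ‖(X / (‖X‖ : ℂ)) ^ k‖ = 1 := by
  rw [norm_zpow, norm_div, Complex.norm_real, norm_norm, div_self (norm_ne_zero_iff.2 hX), one_zpow]

theorem ae_ne_zero : ∀ᵐ X : ℂ, X ≠ 0 := by
  have := (measure_singleton (μ := (volume : Measure ℂ)) 0)
  exact compl_mem_ae_iff.2 this

theorem continuousOn_unit_zpow (k : ℤ) :
    ContinuousOn (fun X : ℂ => (X / (‖X‖ : ℂ)) ^ k) {0}ᶜ := by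
  apply ContinuousOn.zpow₀
  · apply ContinuousOn.div continuousOn_id (by fun_prop)
    intro X hX
    simpa using hX
  · intro X hX
    left
    have : X ≠ 0 := hX
    simp [this]

theorem RadialL2.of_memLp {W : ℂ → ℂ} {g : ℝ → ℂ} {k : ℤ} (hL : MemLp W 2 volume)
    (hW : ∀ᵐ X : ℂ, W X = g ‖X‖ * (X / (‖X‖ : ℂ)) ^ k) : RadialL2 g := by
  have hms : AEStronglyMeasurable (fun X : ℂ => (X / (‖X‖ : ℂ)) ^ (-k)) volume := by
    rw [← restrict_compl_singleton (μ := (volume : Measure ℂ)) 0]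
    exact (continuousOn_unit_zpow _).aestronglyMeasurable (measurableSet_singleton _).compl
  have hg : (fun X : ℂ => g ‖X‖) =ᵐ[volume] fun X => (X / (‖X‖ : ℂ)) ^ (-k) * W X := by
    filter_upwards [hW, ae_ne_zero] with X hX hX0
    have h1 : (X / (‖X‖ : ℂ)) ^ k ≠ 0 := by
      rw [← norm_ne_zero_iff, norm_unit_zpow hX0]; exact one_ne_zero
    rw [hX, zpow_neg]
    field_simp
  have hgL : MemLp (fun X : ℂ => g ‖X‖) 2 volume := by
    have : MemLp (fun X => (X / (‖X‖ : ℂ)) ^ (-k) * W X) 2 volume := by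
      refine hL.of_le (hms.mul hL.1) ?_
      filter_upwards [ae_ne_zero] with X hX0
      rw [norm_mul, norm_unit_zpow hX0, one_mul]
    exact this.ae_eq hg.symm
  refine ⟨?_, ?_⟩
  -- Measurability of `g` is recovered from integrability on discs, whose polar form yields
  -- measurability of `s ↦ s g(s)`.
  · have hU : Set.Ioi (0 : ℝ) = ⋃ N : ℕ, Set.Ioo (0 : ℝ) N := by
      ext x
      simp only [Set.mem_Ioi, Set.mem_iUnion, Set.mem_Ioo, exists_and_left, iff_self_and]
      exact fun _ => exists_nat_gt x
    rw [hU, aestronglyMeasurable_iUnion_iff]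
    intro N
    have h1 : IntegrableOn (fun X : ℂ => g ‖X‖) (Metric.ball 0 N) := by
      have : IsFiniteMeasure ((volume : Measure ℂ).restrict (Metric.ball 0 (N : ℝ))) :=
        ⟨by simpa using measure_ball_lt_top (μ := (volume : Measure ℂ)) (x := 0) (r := (N : ℝ))⟩
      exact (hgL.restrict _).integrable (by norm_num)
    have h2 := (integrableOn_ball_radial_iff.1 h1).1
    have h3 : AEStronglyMeasurable (fun s : ℝ => s⁻¹ • (s • g s)) (volume.restrict (Set.Ioo (0 : ℝ) N)) :=
      AEStronglyMeasurable.fun_smul (by fun_prop) h2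
    refine h3.congr ?_
    filter_upwards [ae_restrict_mem measurableSet_Ioo] with s hs
    rw [smul_smul, inv_mul_cancel₀ hs.1.ne', one_smul]
  · have h1 := hgL.norm.integrable_sq
    have h2 := (integrable_radial_iff (f := fun s => ‖g s‖ ^ 2)).1 h1
    simpa using h2

/-- The weighted inequality `2 |q| |g| ≤ s |g|² + q² / s`. -/
theorem RadialL2.integrableOn_of_sq {g : ℝ → ℂ} (h : RadialL2 g) {q : ℝ → ℝ} {S : Set ℝ}
    (hS : MeasurableSet S) (hS0 : S ⊆ Set.Ioi 0) (hqm : Measurable q)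
    (hq : IntegrableOn (fun s => s⁻¹ * q s ^ 2) S) :
    IntegrableOn (fun s => (q s : ℂ) * g s) S := by
  have h1 := (h.sq.mono_set hS0).add hq
  refine h1.mono' ?_ ?_
  · apply AEStronglyMeasurable.fun_mul
    · exact (Complex.measurable_ofReal.comp hqm).aestronglyMeasurable
    · exact h.aesm.mono_measure (Measure.restrict_mono hS0 le_rfl)
  · filter_upwards [ae_restrict_mem hS] with s hs
    have hs0 : 0 < s := hS0 hs
    rw [norm_mul, Complex.norm_real, Real.norm_eq_abs]
    simp only [Pi.add_apply]
    have h2 : s * (‖g s‖ - s⁻¹ * |q s|) ^ 2 = s * ‖g s‖ ^ 2 + s⁻¹ * q s ^ 2 - 2 * (|q s| * ‖g s‖) := by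
      rw [← sq_abs (q s)]; field_simp; ring
    have h3 : 0 ≤ s * (‖g s‖ - s⁻¹ * |q s|) ^ 2 := by positivity
    have h4 : 0 ≤ |q s| * ‖g s‖ := by positivity
    linarith

theorem RadialL2.integrableOn_inner {g : ℝ → ℂ} (h : RadialL2 g) (m : ℕ) (R : ℝ) :
    IntegrableOn (fun s : ℝ => (s : ℂ) ^ (m + 1) * g s) (Set.Ioc 0 R) := by
  have := h.integrableOn_of_sq (q := fun s => s ^ (m + 1)) (S := Set.Ioc 0 R) measurableSet_Ioc
    (fun s hs => hs.1) (by fun_prop) ?_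
  · simpa using this
  · have : IntegrableOn (fun s : ℝ => s ^ (2 * m + 1)) (Set.Ioc 0 R) :=
      (by fun_prop : Continuous fun s : ℝ => s ^ (2 * m + 1)).integrableOn_Ioc
    refine this.congr_fun (fun s hs => ?_) measurableSet_Ioc
    have := hs.1.ne'
    field_simp
    ring

/-- Here `q = s^{1-m}`, so `q² / s = s^{1-2m}`, integrable at infinity exactly when `m ≥ 2`. This is
where the symmetry `n ≥ 2` matters. -/
theorem RadialL2.integrableOn_outer {g : ℝ → ℂ} (h : RadialL2 g) {m : ℕ} (hm : 2 ≤ m) {R : ℝ}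
    (hR : 0 < R) : IntegrableOn (fun s : ℝ => (s : ℂ) * ((s : ℂ) ^ m)⁻¹ * g s) (Set.Ioi R) := by
  have := h.integrableOn_of_sq (q := fun s => s * (s ^ m)⁻¹) (S := Set.Ioi R) measurableSet_Ioi
    (fun s hs => hR.trans hs) (by fun_prop) ?_
  · simpa using this
  · have h1 : IntegrableOn (fun s : ℝ => s ^ (1 - 2 * m : ℝ)) (Set.Ioi R) := by
      apply integrableOn_Ioi_rpow_of_lt _ hR
      have : (2 : ℝ) ≤ m := by exact_mod_cast hm
      linarith
    refine h1.congr_fun (fun s hs => ?_) measurableSet_Ioi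
    have hs0 : 0 < s := hR.trans hs
    simp only
    rw [Real.rpow_sub hs0, Real.rpow_one, mul_comm 2 (m : ℝ), Real.rpow_mul hs0.le, Real.rpow_natCast]
    norm_num
    field_simp

/-! ### Angular integrals of the Cauchy kernel -/

/-- Cauchy's formula for `z^m`, with `dz = i z dφ`. -/
theorem integral_circle_pow_div {s : ℝ} (m : ℕ) {w : ℂ} (hw : ‖w‖ < s) :
    ∫ φ in (0 : ℝ)..2 * Real.pi, circleMap 0 s φ ^ (m + 1) / (circleMap 0 s φ - w) =
      2 * Real.pi * w ^ m := by
  have h1 := Complex.circleIntegral_sub_inv_smul_of_differentiable_on_off_countable (R := s) (c := 0)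
    (w := w) (f := fun z => z ^ m) Set.countable_empty (by simpa using hw)
    (by fun_prop) (fun x _ => by fun_prop)
  rw [circleIntegral] at h1
  simp only [deriv_circleMap, smul_eq_mul] at h1
  have h2 : ∫ φ in (0 : ℝ)..2 * Real.pi, circleMap 0 s φ * Complex.I * ((circleMap 0 s φ - w)⁻¹ * circleMap 0 s φ ^ m)
     = Complex.I * ∫ φ in (0 : ℝ)..2 * Real.pi, circleMap 0 s φ ^ (m + 1) / (circleMap 0 s φ - w) := by
    rw [← intervalIntegral.integral_const_mul]
    congr 1
    ext φ
    rw [pow_succ]; ring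
  rw [h2] at h1
  apply mul_left_cancel₀ Complex.I_ne_zero
  rw [h1]; ring

theorem integral_circle_pow_div_of_lt {s : ℝ} (hs : 0 < s) (m : ℕ) {w : ℂ} (hw : s < ‖w‖) :
    ∫ φ in (0 : ℝ)..2 * Real.pi, circleMap 0 s φ ^ (m + 1) / (circleMap 0 s φ - w) = 0 := by
  have hne : ∀ z ∈ Metric.closedBall (0 : ℂ) s, z - w ≠ 0 := by
    intro z hz h0
    rw [sub_eq_zero] at h0
    rw [mem_closedBall_zero_iff, h0] at hz
    linarith
  have h1 := Complex.circleIntegral_eq_zero_of_differentiable_on_off_countable (R := s) hs.le (c := 0)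
    (f := fun z => (z - w)⁻¹ * z ^ m) Set.countable_empty
    (ContinuousOn.mul (ContinuousOn.inv₀ (by fun_prop) hne) (by fun_prop))
    (fun x hx => DifferentiableAt.mul (DifferentiableAt.inv (by fun_prop)
      (hne x (Metric.ball_subset_closedBall hx.1))) (by fun_prop))
  rw [circleIntegral] at h1
  simp only [deriv_circleMap, smul_eq_mul] at h1
  have h2 : ∫ φ in (0 : ℝ)..2 * Real.pi, circleMap 0 s φ * Complex.I * ((circleMap 0 s φ - w)⁻¹ * circleMap 0 s φ ^ m)
     = Complex.I * ∫ φ in (0 : ℝ)..2 * Real.pi, circleMap 0 s φ ^ (m + 1) / (circleMap 0 s φ - w) := by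
    rw [← intervalIntegral.integral_const_mul]
    congr 1
    ext φ
    rw [pow_succ]; ring
  rw [h2] at h1
  exact (mul_eq_zero.1 h1).resolve_left Complex.I_ne_zero

/-- The `k`-th Fourier coefficient on the circle of radius `s` of the Cauchy kernel. -/
noncomputable def cauchyMode (k : ℤ) (X : ℂ) (s : ℝ) : ℂ :=
  ∫ φ in Set.Ioo (-Real.pi) Real.pi, (X - circleMap 0 s φ)⁻¹ * (circleMap 0 s φ / s) ^ k

theorem cauchyMode_eq (k : ℤ) (X : ℂ) (s : ℝ) : cauchyMode k X s =
    ∫ φ in (0 : ℝ)..2 * Real.pi, (X - circleMap 0 s φ)⁻¹ * (circleMap 0 s φ / s) ^ k := by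
  have hp : Function.Periodic (fun φ : ℝ => (X - circleMap 0 s φ)⁻¹ * (circleMap 0 s φ / s) ^ k)
      (2 * Real.pi) := by
    intro φ
    simp only [periodic_circleMap 0 s φ]
  have h1 := hp.intervalIntegral_add_eq 0 (-Real.pi)
  rw [zero_add] at h1
  rw [h1, cauchyMode, ← integral_Ioc_eq_integral_Ioo, intervalIntegral.integral_of_le (by linarith [Real.pi_pos])]
  congr 3
  ring

/-- The pole is inside the circle and Cauchy's formula applies; a pole outside gives zero. Positive
modes therefore act only from radii `s > ‖X‖` and, by reflection, nonpositive modes only from `s <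
‖X‖`. This separation produces the outer and inner parts of the potential. -/
theorem cauchyMode_pos_outer {s : ℝ} (m : ℕ) {X : ℂ} (hX : ‖X‖ < s) :
    cauchyMode (m + 1 : ℕ) X s = -(2 * Real.pi) * X ^ m * ((s : ℂ) ^ (m + 1))⁻¹ := by
  rw [cauchyMode_eq]
  have h2 : ∫ φ in (0 : ℝ)..2 * Real.pi, (X - circleMap 0 s φ)⁻¹ * (circleMap 0 s φ / s) ^ ((m + 1 : ℕ) : ℤ)
     = -((s : ℂ) ^ (m + 1))⁻¹ * ∫ φ in (0 : ℝ)..2 * Real.pi, circleMap 0 s φ ^ (m + 1) / (circleMap 0 s φ - X) := by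
    rw [← intervalIntegral.integral_const_mul]
    congr 1
    ext φ
    rw [zpow_natCast, div_pow, ← neg_sub X, div_neg]
    ring
  rw [h2, integral_circle_pow_div m hX]
  ring

theorem cauchyMode_pos_inner {s : ℝ} (hs : 0 < s) (m : ℕ) {X : ℂ} (hX : s < ‖X‖) :
    cauchyMode (m + 1 : ℕ) X s = 0 := by
  rw [cauchyMode_eq]
  have h2 : ∫ φ in (0 : ℝ)..2 * Real.pi, (X - circleMap 0 s φ)⁻¹ * (circleMap 0 s φ / s) ^ ((m + 1 : ℕ) : ℤ)
     = -((s : ℂ) ^ (m + 1))⁻¹ * ∫ φ in (0 : ℝ)..2 * Real.pi, circleMap 0 s φ ^ (m + 1) / (circleMap 0 s φ - X) := by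
    rw [← intervalIntegral.integral_const_mul]
    congr 1
    ext φ
    rw [zpow_natCast, div_pow, ← neg_sub X, div_neg]
    ring
  rw [h2, integral_circle_pow_div_of_lt hs m hX, mul_zero]

/-- On the circle `conj Y = s² / Y`, so conjugation turns a nonpositive mode into a Cauchy integral
of a power, with its pole at the reflected point `s² / conj X`. -/
theorem cauchyMode_neg_eq {s : ℝ} (hs : 0 < s) (m : ℕ) {X : ℂ} (hX : X ≠ 0) :
    cauchyMode (-(m : ℕ)) X s = (starRingEnd ℂ) ((((starRingEnd ℂ) X)⁻¹ * ((s : ℂ) ^ m)⁻¹) *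
      ∫ φ in (0 : ℝ)..2 * Real.pi, circleMap 0 s φ ^ (m + 1) /
        (circleMap 0 s φ - (s : ℂ) ^ 2 / (starRingEnd ℂ) X)) := by
  rw [cauchyMode_eq, ← intervalIntegral.integral_const_mul,
    intervalIntegral.integral_of_le Real.two_pi_pos.le,
    intervalIntegral.integral_of_le Real.two_pi_pos.le, ← integral_conj]
  congr 1
  ext φ
  have hsc : (s : ℂ) ≠ 0 := by exact_mod_cast hs.ne'
  have hY : circleMap 0 s φ ≠ 0 := circleMap_ne_center hs.ne'
  have hYc : (starRingEnd ℂ) (circleMap 0 s φ) * circleMap 0 s φ = (s : ℂ) ^ 2 := by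
    rw [mul_comm, Complex.mul_conj, Complex.normSq_eq_norm_sq, norm_circleMap_zero, sq_abs]
    push_cast; rfl
  set Y := circleMap 0 s φ
  have hYc' : (starRingEnd ℂ) Y ≠ 0 := by simpa using hY
  have hXc' : (starRingEnd ℂ) X ≠ 0 := by simpa using hX
  apply (starRingEnd ℂ).injective
  simp only [map_mul, map_inv₀, map_div₀, map_sub, map_pow, Complex.conj_conj, map_zpow₀, Complex.conj_ofReal]
  rw [zpow_neg, zpow_natCast]
  have e1 : (starRingEnd ℂ) Y = (s : ℂ) ^ 2 / Y := by rw [← hYc]; field_simp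
  rw [e1]
  -- When the pole is at `Y` itself, both integrands vanish by the convention `0⁻¹ = 0`.
  rcases eq_or_ne ((starRingEnd ℂ) X * Y) ((s : ℂ) ^ 2) with h0 | h0
  · have : (starRingEnd ℂ) X - (s : ℂ) ^ 2 / Y = 0 := by rw [← h0]; field_simp; simp
    rw [this]
    have : Y - (s : ℂ) ^ 2 / (starRingEnd ℂ) X = 0 := by rw [← h0]; field_simp; simp
    rw [this]
    simp
  · have h1 : (starRingEnd ℂ) X * Y - (s : ℂ) ^ 2 ≠ 0 := sub_ne_zero.2 h0
    have e2 : (starRingEnd ℂ) X - (s : ℂ) ^ 2 / Y = ((starRingEnd ℂ) X * Y - (s : ℂ) ^ 2) / Y := by field_simp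
    have e3 : Y - (s : ℂ) ^ 2 / (starRingEnd ℂ) X = ((starRingEnd ℂ) X * Y - (s : ℂ) ^ 2) / (starRingEnd ℂ) X := by
      field_simp
    have e4 : (s : ℂ) ^ 2 / Y / s = s / Y := by field_simp
    rw [e2, e3, e4, inv_div, ← inv_pow, inv_div, div_pow]
    have := pow_ne_zero m hY
    field_simp
    ring

theorem cauchyMode_neg_inner {s : ℝ} (hs : 0 < s) (m : ℕ) {X : ℂ} (hX : s < ‖X‖) :
    cauchyMode (-(m : ℕ)) X s = 2 * Real.pi * (s : ℂ) ^ m * (X ^ (m + 1))⁻¹ := by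
  have hX0 : X ≠ 0 := by rw [← norm_pos_iff]; linarith
  have hsc : (s : ℂ) ≠ 0 := by exact_mod_cast hs.ne'
  rw [cauchyMode_neg_eq hs m hX0, integral_circle_pow_div]
  · simp only [map_mul, map_inv₀, map_div₀, map_pow, Complex.conj_conj, Complex.conj_ofReal, map_ofNat, div_pow]
    field_simp
    ring
  · rw [norm_div, norm_pow, Complex.norm_real, Real.norm_of_nonneg hs.le, Complex.norm_conj,
      div_lt_iff₀ (by linarith)]
    nlinarith

theorem cauchyMode_neg_outer {s : ℝ} (hs : 0 < s) (m : ℕ) {X : ℂ} (hX0 : X ≠ 0) (hX : ‖X‖ < s) :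
    cauchyMode (-(m : ℕ)) X s = 0 := by
  rw [cauchyMode_neg_eq hs m hX0, integral_circle_pow_div_of_lt hs]
  · simp
  · have : 0 < ‖X‖ := norm_pos_iff.2 hX0
    rw [norm_div, norm_pow, Complex.norm_real, Real.norm_of_nonneg hs.le, Complex.norm_conj,
      lt_div_iff₀ this]
    nlinarith

/-! ### Cauchy transforms of a single mode in polar coordinates. -/

theorem polarCoord_symm_eq_circleMap (p : ℝ × ℝ) :
    Complex.polarCoord.symm p = circleMap 0 p.1 p.2 := by
  rw [Complex.polarCoord_symm_apply, circleMap, zero_add, Complex.exp_mul_I, Complex.ofReal_cos,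
    Complex.ofReal_sin]

theorem integrableOn_polar {f : ℂ → ℂ} (hf : Integrable f) :
    IntegrableOn (fun p : ℝ × ℝ => p.1 • f (circleMap 0 p.1 p.2))
      (Set.Ioi (0 : ℝ) ×ˢ Set.Ioo (-Real.pi) Real.pi) := by
  have h1 : Integrable (fun p : ℝ × ℝ => f (Complex.measurableEquivRealProd.symm p)) :=
    (Complex.volume_preserving_equiv_real_prod.symm).integrable_comp_of_integrable hf
  have h2 := (integrableOn_image_iff_integrableOn_abs_det_fderiv_smul volume
    polarCoord.open_target.measurableSet
    (fun p _ ↦ (hasFDerivAt_polarCoord_symm p).hasFDerivWithinAt)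
    polarCoord.symm.injOn _).1 h1.integrableOn
  refine h2.congr_fun (fun p hp => ?_) polarCoord.open_target.measurableSet
  simp only
  rw [det_fderivPolarCoordSymm, abs_of_pos hp.1,
    Complex.measurableEquivRealProd_symm_polarCoord_symm_apply, polarCoord_symm_eq_circleMap]

theorem integral_polar {f : ℂ → ℂ} (hf : Integrable f) :
    ∫ X, f X = ∫ s in Set.Ioi (0 : ℝ), s * ∫ φ in Set.Ioo (-Real.pi) Real.pi, f (circleMap 0 s φ) := by
  rw [← Complex.integral_comp_polarCoord_symm]
  have h2 := integrableOn_polar hf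
  rw [IntegrableOn, Measure.volume_eq_prod, ← Measure.prod_restrict] at h2
  simp only [polarCoord_symm_eq_circleMap, polarCoord_target]
  rw [Measure.volume_eq_prod, ← Measure.prod_restrict, integral_prod _ h2]
  simp only [Complex.real_smul, integral_const_mul]

/-- The Cauchy kernel is absolutely integrable against a locally integrable function, for almost
every base point. -/
theorem ae_integrableOn_cauchy {W : ℂ → ℂ} (hW : LocallyIntegrable W) :
    ∀ᵐ X : ℂ, ∀ ρ : ℝ, IntegrableOn (fun Y => (X - Y)⁻¹ * W Y) (Metric.ball 0 ρ) := by
  have hk : ∀ N : ℕ, IntegrableOn (fun Z : ℂ => Z⁻¹) (Metric.ball 0 N) := by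
    intro N
    have h1 : IntegrableOn (fun X : ℂ => ‖X‖⁻¹) (Metric.ball 0 N) := by
      rw [integrableOn_ball_radial_iff (f := fun s => s⁻¹)]
      have : IntegrableOn (fun _ : ℝ => (1 : ℝ)) (Set.Ioo 0 (N : ℝ)) := by
        simp
      refine this.congr_fun (fun s hs => ?_) measurableSet_Ioo
      have := hs.1.ne'
      simp only [smul_eq_mul]
      field_simp
    refine h1.mono' (by fun_prop) (Eventually.of_forall fun X => ?_)
    rw [norm_inv]
  have main : ∀ N : ℕ, ∀ᵐ X : ℂ, X ∈ Metric.ball (0 : ℂ) N →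
      IntegrableOn (fun Y => (X - Y)⁻¹ * W Y) (Metric.ball 0 (N : ℝ)) := by
    intro N
    have hf : Integrable ((Metric.ball (0 : ℂ) N).indicator W) :=
      (integrable_indicator_iff measurableSet_ball).2
        ((hW.integrableOn_isCompact (isCompact_closedBall 0 (N : ℝ))).mono_set Metric.ball_subset_closedBall)
    -- Radius `2N` contains every difference of two points of the disc of radius `N`, so cutting off
    -- the kernel there changes nothing and turns the integrand into that of a convolution of two
    -- `L¹` functions.
    have hg : Integrable ((Metric.ball (0 : ℂ) (2 * N : ℕ)).indicator fun Z : ℂ => Z⁻¹) :=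
      (integrable_indicator_iff measurableSet_ball).2 (hk _)
    have h := Integrable.ae_convolution_exists (μ := volume) (ν := volume) (ContinuousLinearMap.mul ℝ ℂ) hf hg
    filter_upwards [h] with X hX hXN
    have h1 := Integrable.integrableOn (s := Metric.ball (0 : ℂ) (N : ℝ)) hX
    refine h1.congr_fun (fun Y hY => ?_) measurableSet_ball
    have h2 : X - Y ∈ Metric.ball (0 : ℂ) (2 * N : ℕ) := by
      rw [mem_ball_zero_iff] at hY hXN ⊢
      push_cast
      linarith [norm_sub_le X Y]
    simp only [ContinuousLinearMap.mul_apply', Set.indicator_of_mem hY, Set.indicator_of_mem h2]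
    ring
  rw [← ae_all_iff] at main
  filter_upwards [main] with X hX ρ
  obtain ⟨N, hN⟩ := exists_nat_gt (max ρ ‖X‖)
  refine (hX N ?_).mono_set (Metric.ball_subset_ball ((le_max_left _ _).trans hN.le))
  rw [mem_ball_zero_iff]
  exact (le_max_right _ _).trans_lt hN

theorem setIntegral_cauchy_eq_cauchyMode {W : ℂ → ℂ} {g : ℝ → ℂ} {k : ℤ}
    (hW : ∀ᵐ X : ℂ, W X = g ‖X‖ * (X / (‖X‖ : ℂ)) ^ k) {X : ℂ} {ρ : ℝ}
    (hX : IntegrableOn (fun Y => (X - Y)⁻¹ * W Y) (Metric.ball 0 ρ)) :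
    ∫ Y in Metric.ball 0 ρ, (X - Y)⁻¹ * W Y =
      ∫ s in Set.Ioo 0 ρ, s * g s * cauchyMode k X s := by
  set f : ℂ → ℂ := (Metric.ball 0 ρ).indicator fun Y => (X - Y)⁻¹ * (g ‖Y‖ * (Y / (‖Y‖ : ℂ)) ^ k)
  have e : (Metric.ball 0 ρ).indicator (fun Y => (X - Y)⁻¹ * W Y) =ᵐ[volume] f := by
    filter_upwards [hW] with Y hY
    simp only [f, Set.indicator, hY]
  have hf : Integrable f := ((integrable_indicator_iff measurableSet_ball).2 hX).congr e
  rw [← integral_indicator measurableSet_ball, integral_congr_ae e, integral_polar hf,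
    ← integral_indicator measurableSet_Ioo, ← integral_indicator measurableSet_Ioi]
  congr 1
  ext s
  by_cases hs : 0 < s
  · rw [Set.indicator_of_mem (Set.mem_Ioi.2 hs)]
    by_cases hsρ : s < ρ
    · rw [Set.indicator_of_mem (Set.mem_Ioo.2 ⟨hs, hsρ⟩), cauchyMode, mul_assoc, ← integral_const_mul (g s)]
      congr 2
      ext φ
      have h1 : circleMap 0 s φ ∈ Metric.ball (0 : ℂ) ρ := by simpa [abs_of_pos hs] using hsρ
      simp only [f]
      rw [Set.indicator_of_mem h1]
      simp only [norm_circleMap_zero, abs_of_pos hs]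
      ring
    · rw [Set.indicator_of_notMem (fun h => hsρ h.2)]
      have : ∀ φ, f (circleMap 0 s φ) = 0 := by
        intro φ
        apply Set.indicator_of_notMem
        simpa [abs_of_pos hs] using hsρ
      simp [this]
  · rw [Set.indicator_of_notMem (show s ∉ Set.Ioi 0 from hs), Set.indicator_of_notMem (fun h => hs h.1)]

theorem tendsto_setIntegral_Ioo {f : ℝ → ℂ} (hf : IntegrableOn f (Set.Ioi 0)) :
    Tendsto (fun ρ : ℝ => ∫ s in Set.Ioo 0 ρ, f s) atTop (𝓝 (∫ s in Set.Ioi 0, f s)) := by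
  refine (intervalIntegral_tendsto_integral_Ioi 0 hf tendsto_id).congr' ?_
  filter_upwards [eventually_ge_atTop 0] with ρ hρ
  rw [id, intervalIntegral.integral_of_le hρ, integral_Ioc_eq_integral_Ioo]

/-- The inner part of the radial potential. -/
noncomputable def innerPot (m : ℕ) (g : ℝ → ℂ) (R : ℝ) : ℂ :=
  ∫ s in Set.Ioc 0 R, (s : ℂ) ^ (m + 1) * g s

/-- The outer part of the radial potential. -/
noncomputable def outerPot (m : ℕ) (g : ℝ → ℂ) (R : ℝ) : ℂ :=
  ∫ s in Set.Ioi R, (s : ℂ) * ((s : ℂ) ^ m)⁻¹ * g s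

/-- The radial potential, a multiple of the stream function of the mode `m` vorticity `g`. -/
noncomputable def radialPot (m : ℕ) (g : ℝ → ℂ) (R : ℝ) : ℂ :=
  ((R : ℂ) ^ m)⁻¹ * innerPot m g R + (R : ℂ) ^ m * outerPot m g R

theorem ae_ne_real (R : ℝ) : ∀ᵐ s : ℝ, s ≠ R :=
  compl_mem_ae_iff.2 (measure_singleton R)

/-- Only radii beyond `‖X‖` contribute, and the truncation can be removed because the outer weight
is integrable against `g` for `m ≥ 2`. For the opposite modes the contributing radii are bounded,
and no lower bound on `m` is needed. -/
theorem tendsto_cauchy_pos {W : ℂ → ℂ} {g : ℝ → ℂ} {m : ℕ} (hm : 2 ≤ m) (hg : RadialL2 g)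
    (hW : ∀ᵐ X : ℂ, W X = g ‖X‖ * (X / (‖X‖ : ℂ)) ^ (m : ℤ)) {X : ℂ} (hX0 : X ≠ 0)
    (hX : ∀ ρ : ℝ, IntegrableOn (fun Y => (X - Y)⁻¹ * W Y) (Metric.ball 0 ρ)) :
    Tendsto (fun ρ : ℝ => ∫ Y in Metric.ball 0 ρ, (X - Y)⁻¹ * W Y) atTop
      (𝓝 (-(2 * Real.pi) * X ^ (m - 1) * outerPot m g ‖X‖)) := by
  have hXn : 0 < ‖X‖ := norm_pos_iff.2 hX0
  obtain ⟨m, rfl⟩ : ∃ l, m = l + 1 := ⟨m - 1, by omega⟩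
  set F : ℝ → ℂ := (Set.Ioi ‖X‖).indicator fun s : ℝ =>
    -(2 * Real.pi) * X ^ m * ((s : ℂ) * ((s : ℂ) ^ (m + 1))⁻¹ * g s)
  have hF : IntegrableOn F (Set.Ioi 0) :=
    ((integrable_indicator_iff measurableSet_Ioi).2
      ((hg.integrableOn_outer hm hXn).const_mul _)).integrableOn
  have h1 := tendsto_setIntegral_Ioo hF
  have h2 : ∫ s in Set.Ioi 0, F s = -(2 * Real.pi) * X ^ m * outerPot (m + 1) g ‖X‖ := by
    rw [setIntegral_indicator measurableSet_Ioi, Set.Ioi_inter_Ioi, sup_eq_right.2 hXn.le,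
      integral_const_mul, outerPot]
  rw [h2] at h1
  refine h1.congr fun ρ => ?_
  rw [setIntegral_cauchy_eq_cauchyMode hW (hX ρ)]
  apply setIntegral_congr_ae measurableSet_Ioo
  filter_upwards [ae_ne_real ‖X‖] with s hs hs0
  rcases lt_or_gt_of_ne hs with h | h
  · rw [cauchyMode_pos_inner hs0.1 m h, mul_zero]
    exact Set.indicator_of_notMem (by simpa using h.le) _
  · rw [cauchyMode_pos_outer m h]
    simp only [F]
    rw [Set.indicator_of_mem (Set.mem_Ioi.2 h)]
    ring

theorem tendsto_cauchy_neg {W : ℂ → ℂ} {g : ℝ → ℂ} {m : ℕ} (hg : RadialL2 g)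
    (hW : ∀ᵐ X : ℂ, W X = g ‖X‖ * (X / (‖X‖ : ℂ)) ^ (-(m : ℤ))) {X : ℂ} (hX0 : X ≠ 0)
    (hX : ∀ ρ : ℝ, IntegrableOn (fun Y => (X - Y)⁻¹ * W Y) (Metric.ball 0 ρ)) :
    Tendsto (fun ρ : ℝ => ∫ Y in Metric.ball 0 ρ, (X - Y)⁻¹ * W Y) atTop
      (𝓝 (2 * Real.pi * (X ^ (m + 1))⁻¹ * innerPot m g ‖X‖)) := by
  have hXn : 0 < ‖X‖ := norm_pos_iff.2 hX0
  set F : ℝ → ℂ := (Set.Ioc 0 ‖X‖).indicator fun s : ℝ =>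
    2 * Real.pi * (X ^ (m + 1))⁻¹ * ((s : ℂ) ^ (m + 1) * g s)
  have hF : IntegrableOn F (Set.Ioi 0) :=
    ((integrable_indicator_iff measurableSet_Ioc).2
      ((hg.integrableOn_inner m _).const_mul _)).integrableOn
  have h1 := tendsto_setIntegral_Ioo hF
  have h2 : ∫ s in Set.Ioi 0, F s = 2 * Real.pi * (X ^ (m + 1))⁻¹ * innerPot m g ‖X‖ := by
    rw [setIntegral_indicator measurableSet_Ioc, Set.inter_eq_right.2 Set.Ioc_subset_Ioi_self,
      integral_const_mul, innerPot]
  rw [h2] at h1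
  refine h1.congr fun ρ => ?_
  rw [setIntegral_cauchy_eq_cauchyMode hW (hX ρ)]
  apply setIntegral_congr_ae measurableSet_Ioo
  filter_upwards [ae_ne_real ‖X‖] with s hs hs0
  rcases lt_or_gt_of_ne hs with h | h
  · rw [cauchyMode_neg_inner hs0.1 m h]
    simp only [F]
    rw [Set.indicator_of_mem (Set.mem_Ioc.2 ⟨hs0.1, h.le⟩)]
    ring
  · rw [cauchyMode_neg_outer hs0.1 m hX0 h, mul_zero]
    exact Set.indicator_of_notMem (fun h' => by linarith [h'.2]) _

/-- The conjugate of a function of mode `k` is of mode `-k`. -/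
theorem conj_mode {W : ℂ → ℂ} {g : ℝ → ℂ} {k : ℤ}
    (hW : ∀ᵐ X : ℂ, W X = g ‖X‖ * (X / (‖X‖ : ℂ)) ^ k) :
    ∀ᵐ X : ℂ, (starRingEnd ℂ) (W X) = (starRingEnd ℂ) (g ‖X‖) * (X / (‖X‖ : ℂ)) ^ (-k) := by
  filter_upwards [hW, ae_ne_zero] with X hX hX0
  have hXn : (‖X‖ : ℂ) ≠ 0 := by simpa using hX0
  have h : (starRingEnd ℂ) (X / (‖X‖ : ℂ)) = (X / (‖X‖ : ℂ))⁻¹ := by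
    rw [map_div₀, Complex.conj_ofReal, inv_div, div_eq_div_iff hXn hX0, mul_comm, Complex.mul_conj,
      Complex.normSq_eq_norm_sq]
    push_cast; ring
  rw [hX, map_mul, map_zpow₀, h, inv_zpow, zpow_neg]

/-! ### From Cauchy transforms to the Biot–Savart velocity. -/

/-- The two kernels are the imaginary and real parts of `1/z`, up to the factor `1/(2π)`. Since `W`
is complex valued, taking these parts of the kernel alone brings in the Cauchy transforms of both
`W` and its conjugate. -/
theorem biotSavartTrunc_eq {W : ℂ → ℂ} {X : ℂ} {ρ : ℝ}
    (hX : IntegrableOn (fun Y => (X - Y)⁻¹ * W Y) (Metric.ball 0 ρ))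
    (hX' : IntegrableOn (fun Y => (X - Y)⁻¹ * (starRingEnd ℂ) (W Y)) (Metric.ball 0 ρ)) :
    biotSavartTrunc W ρ X =
      (((∫ Y in Metric.ball 0 ρ, (X - Y)⁻¹ * W Y) -
        (starRingEnd ℂ) (∫ Y in Metric.ball 0 ρ, (X - Y)⁻¹ * (starRingEnd ℂ) (W Y))) /
          (4 * Real.pi * Complex.I),
       ((∫ Y in Metric.ball 0 ρ, (X - Y)⁻¹ * W Y) +
        (starRingEnd ℂ) (∫ Y in Metric.ball 0 ρ, (X - Y)⁻¹ * (starRingEnd ℂ) (W Y))) /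
          (4 * Real.pi)) := by
  have hpi : (Real.pi : ℂ) ≠ 0 := by exact_mod_cast Real.pi_ne_zero
  have hc : IntegrableOn (fun Y => (starRingEnd ℂ) ((X - Y)⁻¹ * (starRingEnd ℂ) (W Y)))
      (Metric.ball 0 ρ) := (Complex.conjCLE.toContinuousLinearMap.integrable_comp hX')
  rw [← integral_conj, ← integral_sub hX hc, ← integral_add hX hc, ← integral_div, ← integral_div,
    biotSavartTrunc]
  have key : ∀ z : ℂ, z⁻¹ - (starRingEnd ℂ) z⁻¹ = 2 * Complex.I * ((-z.im / ‖z‖ ^ 2 : ℝ) : ℂ) ∧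
      z⁻¹ + (starRingEnd ℂ) z⁻¹ = 2 * ((z.re / ‖z‖ ^ 2 : ℝ) : ℂ) := by
    intro z
    rw [Complex.sub_conj, Complex.add_conj, Complex.inv_im, Complex.inv_re, Complex.normSq_eq_norm_sq]
    constructor <;> push_cast <;> ring
  congr 1
  · congr 1
    ext Y
    have h := (key (X - Y)).1
    simp only [map_mul, Complex.conj_conj]
    rw [← sub_mul, h]
    push_cast
    field_simp
    ring
  · congr 1
    ext Y
    have h := (key (X - Y)).2
    simp only [map_mul, Complex.conj_conj]
    rw [← add_mul, h]
    push_cast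
    field_simp
    ring

/-- The radial component of the velocity of a mode. -/
theorem velocity_radial {W : ℂ → ℂ} {g : ℝ → ℂ} {k : ℤ} (hk : 2 ≤ k.natAbs) (hL : MemLp W 2 volume)
    (hW : ∀ᵐ X : ℂ, W X = g ‖X‖ * (X / (‖X‖ : ℂ)) ^ k) :
    ∀ᵐ X : ℂ, (velocity W X).1 * (X.re : ℂ) + (velocity W X).2 * (X.im : ℂ) =
      Complex.I * (k.sign : ℂ) / 2 * radialPot k.natAbs g ‖X‖ * (X / (‖X‖ : ℂ)) ^ k := by
  have hg := RadialL2.of_memLp hL hW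
  have hL' : MemLp (fun X => (starRingEnd ℂ) (W X)) 2 volume := hL.star
  have hW' := conj_mode hW
  have hg' := RadialL2.of_memLp hL' (g := fun s => (starRingEnd ℂ) (g s)) hW'
  have hpi : (Real.pi : ℂ) ≠ 0 := by exact_mod_cast Real.pi_ne_zero
  have hinner : ∀ (m : ℕ) R, (starRingEnd ℂ) (innerPot m (fun s => (starRingEnd ℂ) (g s)) R) =
      innerPot m g R := by
    intro m R
    rw [innerPot, ← integral_conj]
    simp [innerPot]
  have houter : ∀ (m : ℕ) R, (starRingEnd ℂ) (outerPot m (fun s => (starRingEnd ℂ) (g s)) R) =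
      outerPot m g R := by
    intro m R
    rw [outerPot, ← integral_conj]
    simp [outerPot]
  filter_upwards [ae_ne_zero, ae_integrableOn_cauchy (hL.locallyIntegrable (by norm_num)),
    ae_integrableOn_cauchy (hL'.locallyIntegrable (by norm_num))] with X hX0 hX hX'
  have hXn : (‖X‖ : ℂ) ≠ 0 := by simpa using hX0
  -- With Cauchy limits `A` for `W` and `B` for its conjugate, the identity `V · X = (A X - conj (B
  -- X)) / (4πi)` reduces the claim to the two mode computations.
  have hlim : ∀ A B : ℂ,
      Tendsto (fun ρ : ℝ => ∫ Y in Metric.ball 0 ρ, (X - Y)⁻¹ * W Y) atTop (𝓝 A) →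
      Tendsto (fun ρ : ℝ => ∫ Y in Metric.ball 0 ρ, (X - Y)⁻¹ * (starRingEnd ℂ) (W Y)) atTop (𝓝 B) →
      (velocity W X).1 * (X.re : ℂ) + (velocity W X).2 * (X.im : ℂ) =
        (A * X - (starRingEnd ℂ) (B * X)) / (4 * Real.pi * Complex.I) := by
    intro A B hA hB
    have hB' := (Complex.continuous_conj.tendsto B).comp hB
    have hv : velocity W X = ((A - (starRingEnd ℂ) B) / (4 * Real.pi * Complex.I),
        (A + (starRingEnd ℂ) B) / (4 * Real.pi)) := by
      apply Tendsto.limUnder_eq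
      have h1 := ((hA.sub hB').div_const (4 * Real.pi * Complex.I)).prodMk_nhds
        ((hA.add hB').div_const (4 * Real.pi : ℂ))
      refine h1.congr fun ρ => ?_
      rw [biotSavartTrunc_eq (hX ρ) (hX' ρ)]
      rfl
    rw [hv]
    have e1 : X = (X.re : ℂ) + X.im * Complex.I := (Complex.re_add_im X).symm
    have e2 : (starRingEnd ℂ) X = (X.re : ℂ) - X.im * Complex.I := by
      apply Complex.ext <;> simp
    rw [map_mul, e2]
    conv_rhs => rw [e1]
    simp only [Complex.add_re, Complex.ofReal_re, Complex.mul_re, Complex.I_re, mul_zero,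
      Complex.ofReal_im, Complex.I_im, mul_one, sub_self, add_zero, Complex.add_im, Complex.mul_im,
      zero_add]
    field_simp
    ring
  have hc : (starRingEnd ℂ) X = (‖X‖ : ℂ) ^ 2 / X := by
    rw [eq_div_iff hX0, mul_comm, Complex.mul_conj, Complex.normSq_eq_norm_sq]
    push_cast; rfl
  have hI : (1 : ℂ) / Complex.I = - Complex.I := by simp
  rcases le_total 0 k with h0 | h0
  · obtain ⟨m, rfl⟩ := Int.eq_ofNat_of_zero_le h0
    have hm : 2 ≤ m := by simpa using hk
    rw [hlim _ _ (tendsto_cauchy_pos hm hg hW hX0 hX) (tendsto_cauchy_neg hg' hW' hX0 hX')]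
    have hs : (m : ℤ).sign = 1 := Int.sign_eq_one_of_pos (by omega)
    rw [hs, Int.natAbs_natCast, radialPot]
    simp only [map_mul, map_inv₀, map_pow, hinner, map_ofNat, Complex.conj_ofReal, hc, zpow_natCast]
    obtain ⟨l, rfl⟩ : ∃ l, m = l + 1 := ⟨m - 1, by omega⟩
    simp only [Nat.add_sub_cancel, div_pow]
    push_cast
    field_simp
    ring_nf
    simp only [Complex.I_sq]
    ring
  · obtain ⟨m, hm'⟩ := Int.eq_ofNat_of_zero_le (neg_nonneg.2 h0)
    obtain rfl : k = -(m : ℤ) := by simpa [neg_eq_iff_eq_neg] using hm'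
    have hm : 2 ≤ m := by simpa using hk
    rw [neg_neg] at hW'
    rw [hlim _ _ (tendsto_cauchy_neg hg hW hX0 hX) (tendsto_cauchy_pos hm hg' hW' hX0 hX')]
    have hs : (-(m : ℤ)).sign = -1 := Int.sign_eq_neg_one_of_neg (by omega)
    rw [hs, Int.natAbs_neg, Int.natAbs_natCast, radialPot]
    simp only [map_mul, map_neg, map_pow, houter, map_ofNat, Complex.conj_ofReal, hc, zpow_natCast, zpow_neg]
    obtain ⟨l, rfl⟩ : ∃ l, m = l + 1 := ⟨m - 1, by omega⟩
    simp only [Nat.add_sub_cancel, div_pow]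
    push_cast
    field_simp
    ring_nf
    simp only [Complex.I_sq]
    ring

/-! ### The regularized vortex profile. -/

theorem contDiff_primitive {f : ℝ → ℝ} (hf : ContDiff ℝ ∞ f) (a : ℝ) :
    ContDiff ℝ ∞ (fun x => ∫ t in a..x, f t) := by
  have h : ∀ x, HasDerivAt (fun x => ∫ t in a..x, f t) (f x) x := fun x =>
    intervalIntegral.integral_hasDerivAt_right (hf.continuous.intervalIntegrable _ _)
      hf.continuous.aestronglyMeasurable.stronglyMeasurableAtFilter hf.continuous.continuousAt
  rw [contDiff_infty_iff_deriv]
  refine ⟨fun x => (h x).differentiableAt, ?_⟩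
  have : deriv (fun x => ∫ t in a..x, f t) = f := funext fun x => (h x).deriv
  rwa [this]

namespace VortexData

variable {P : VortexData}

/-- The primitive of the mollifier, a smooth step from `0` to `1`. -/
noncomputable def step (P : VortexData) (x : ℝ) : ℝ := ∫ t in (-1 : ℝ)..x, P.η t

theorem Admissible.contDiff_step (hP : P.Admissible) : ContDiff ℝ ∞ P.step :=
  contDiff_primitive hP.η_smooth _

theorem Admissible.η_eq_zero (hP : P.Admissible) {x : ℝ} (hx : x ≤ -1 ∨ 1 ≤ x) : P.η x = 0 := by
  apply image_eq_zero_of_notMem_tsupport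
  intro h
  have := hP.η_supp h
  rcases hx with hx | hx
  · linarith [this.1]
  · linarith [this.2]

theorem Admissible.step_of_le (hP : P.Admissible) {x : ℝ} (hx : x ≤ -1) : P.step x = 0 := by
  rw [step, intervalIntegral.integral_symm, neg_eq_zero]
  apply intervalIntegral.integral_zero_ae
  refine Eventually.of_forall fun t ht => hP.η_eq_zero ?_
  rw [Set.uIoc_of_le hx] at ht
  exact Or.inl ht.2

theorem Admissible.step_of_ge (hP : P.Admissible) {x : ℝ} (hx : 1 ≤ x) : P.step x = 1 := by
  rw [step, intervalIntegral.integral_eq_integral_of_support_subset, hP.η_integral]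
  intro t ht
  have := hP.η_supp (subset_tsupport _ ht)
  exact ⟨this.1, by linarith [this.2]⟩

theorem Admissible.cutoff_eq (hP : P.Admissible) (r : ℝ) :
    P.cutoff r = P.step ((r - P.r₁) / P.ε) - P.step ((r - P.r₂) / P.ε) := by
  have hε := hP.ε_pos
  have hi : ∀ a b : ℝ, IntervalIntegrable P.η volume a b := fun a b =>
    hP.η_smooth.continuous.intervalIntegrable _ _
  rw [step, step, intervalIntegral.integral_interval_sub_left (hi _ _) (hi _ _), cutoff,
    intervalIntegral.integral_const_mul]
  simp only [sub_div]
  rw [intervalIntegral.integral_comp_sub_div _ hε.ne', smul_eq_mul, ← mul_assoc,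
    inv_mul_cancel₀ hε.ne', one_mul]

/-- The two transition layers are disjoint because `3ε < r₂ - r₁`, so at each radius at least one
step is already constant. The single formula makes smoothness visible across the case boundaries. -/
theorem Admissible.vθ_eq (hP : P.Admissible) (r : ℝ) :
    P.vθ r = P.v₁ r * (1 - P.step ((r - P.r₁) / P.ε)) +
      P.v₂ r * (P.step ((r - P.r₁) / P.ε) * (1 - P.step ((r - P.r₂) / P.ε))) := by
  have hε := hP.ε_pos
  have h12 : 3 * P.ε < P.r₂ - P.r₁ := by
    have := hP.ε_lt.trans_le (div_le_div_of_nonneg_right (min_le_right _ _) (by norm_num))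
    linarith
  have hlo : ∀ a : ℝ, r ≤ a - P.ε → P.step ((r - a) / P.ε) = 0 := fun a ha =>
    hP.step_of_le (by rw [div_le_iff₀ hε]; linarith)
  have hhi : ∀ a : ℝ, a + P.ε ≤ r → P.step ((r - a) / P.ε) = 1 := fun a ha =>
    hP.step_of_ge (by rw [le_div_iff₀ hε]; linarith)
  rw [vθ]
  split_ifs with h1 h2
  · rw [abs_lt] at h1
    rw [hP.cutoff_eq, hlo P.r₂ (by linarith)]
    ring
  · rw [abs_lt] at h2
    rw [hP.cutoff_eq, hhi P.r₁ (by linarith)]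
    ring
  · rw [vSharp]
    rw [not_lt, le_abs] at h1 h2
    split_ifs with h3 h4
    · have h1' : r ≤ P.r₁ - P.ε := by rcases h1 with h1 | h1 <;> linarith
      rw [hlo P.r₁ h1']; ring
    · have h1' : P.r₁ + P.ε ≤ r := by rcases h1 with h1 | h1 <;> linarith
      have h2' : r ≤ P.r₂ - P.ε := by rcases h2 with h2 | h2 <;> linarith
      rw [hhi P.r₁ h1', hlo P.r₂ h2']; ring
    · have h1' : P.r₁ + P.ε ≤ r := by rcases h1 with h1 | h1 <;> linarith
      have h2' : P.r₂ + P.ε ≤ r := by rcases h2 with h2 | h2 <;> linarith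
      rw [hhi P.r₁ h1', hhi P.r₂ h2']; ring

theorem Admissible.contDiffOn_vθ (hP : P.Admissible) : ContDiffOn ℝ ∞ P.vθ (Set.Ioi 0) := by
  have : P.vθ = fun r => P.v₁ r * (1 - P.step ((r - P.r₁) / P.ε)) +
      P.v₂ r * (P.step ((r - P.r₁) / P.ε) * (1 - P.step ((r - P.r₂) / P.ε))) := funext hP.vθ_eq
  rw [this]
  have hs : ∀ a : ℝ, ContDiffOn ℝ ∞ (fun r => P.step ((r - a) / P.ε)) (Set.Ioi 0) := fun a =>
    (hP.contDiff_step.comp (by fun_prop : ContDiff ℝ ∞ fun r => (r - a) / P.ε)).contDiffOn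
  have hv1 : ContDiffOn ℝ ∞ P.v₁ (Set.Ioi 0) := by
    unfold v₁; fun_prop
  have hv2 : ContDiffOn ℝ ∞ P.v₂ (Set.Ioi 0) := by
    unfold v₂
    apply ContDiffOn.mul (by fun_prop)
    apply ContDiffOn.sub _ contDiffOn_const
    apply ContDiffOn.pow
    exact contDiffOn_const.div contDiffOn_id fun x hx => (ne_of_gt hx)
  exact (hv1.mul (contDiffOn_const.sub (hs _))).add
    (hv2.mul ((hs _).mul (contDiffOn_const.sub (hs _))))

theorem Admissible.vθ_inner (hP : P.Admissible) {r : ℝ} (hr : r ≤ P.r₁ - P.ε) :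
    P.vθ r = P.c * r / 2 := by
  rw [hP.vθ_eq, hP.step_of_le (by rw [div_le_iff₀ hP.ε_pos]; linarith), v₁]
  ring

theorem Admissible.vθ_outer (hP : P.Admissible) {r : ℝ} (hr : P.r₂ + P.ε ≤ r) : P.vθ r = 0 := by
  have := hP.r₁_lt_r₂
  rw [hP.vθ_eq, hP.step_of_ge (x := (r - P.r₁) / P.ε) (by rw [le_div_iff₀ hP.ε_pos]; linarith),
    hP.step_of_ge (by rw [le_div_iff₀ hP.ε_pos]; linarith)]
  ring

theorem Admissible.ε_lt_r₁ (hP : P.Admissible) : P.ε < P.r₁ := by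
  have := hP.ε_lt.trans_le (div_le_div_of_nonneg_right (min_le_left _ _) (by norm_num))
  linarith [hP.r₁_pos]

theorem Admissible.contDiffOn_w (hP : P.Admissible) : ContDiffOn ℝ ∞ P.w (Set.Ioi 0) := by
  have h1 : ContDiffOn ℝ ∞ (deriv fun s => s * P.vθ s) (Set.Ioi 0) :=
    (contDiffOn_id.mul hP.contDiffOn_vθ).deriv_of_isOpen isOpen_Ioi (by simp)
  refine (h1.div contDiffOn_id fun x hx => ne_of_gt hx).congr fun x hx => ?_
  rw [w, if_neg (ne_of_gt hx)]
  rfl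

theorem Admissible.deriv_w_inner (hP : P.Admissible) {r : ℝ} (hr0 : 0 < r) (hr : r < P.r₁ - P.ε) :
    deriv P.w r = 0 := by
  have h1 : ∀ x ∈ Set.Ioo 0 (P.r₁ - P.ε), P.w x = P.c := by
    intro x hx
    rw [w, if_neg hx.1.ne']
    have h2 : (fun s => s * P.vθ s) =ᶠ[𝓝 x] fun s => P.c / 2 * s ^ 2 := by
      filter_upwards [Iio_mem_nhds hx.2] with s hs
      rw [hP.vθ_inner (le_of_lt hs)]; ring
    rw [h2.deriv_eq]
    have := hx.1.ne'
    simp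
    field_simp
  have h2 : P.w =ᶠ[𝓝 r] fun _ => P.c := by
    filter_upwards [Ioo_mem_nhds hr0 hr] with x hx using h1 x hx
  rw [h2.deriv_eq, deriv_const]

theorem Admissible.deriv_w_outer (hP : P.Admissible) {r : ℝ} (hr : P.r₂ + P.ε < r) :
    deriv P.w r = 0 := by
  have hpos : 0 < P.r₂ + P.ε := by linarith [hP.r₁_pos, hP.r₁_lt_r₂, hP.ε_pos]
  have h1 : ∀ x ∈ Set.Ioi (P.r₂ + P.ε), P.w x = 0 := by
    intro x hx
    rw [w, if_neg (hpos.trans hx).ne']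
    have h2 : (fun s => s * P.vθ s) =ᶠ[𝓝 x] fun s => 0 := by
      filter_upwards [Ioi_mem_nhds hx] with s hs
      rw [hP.vθ_outer (le_of_lt hs)]; ring
    rw [h2.deriv_eq]
    simp
  have h2 : P.w =ᶠ[𝓝 r] fun _ => 0 := by
    filter_upwards [Ioi_mem_nhds hr] with x hx using h1 x hx
  rw [h2.deriv_eq, deriv_const]

end VortexData

/-! ### The nonlocal term on a single mode. -/

theorem hasDerivAt_norm_curve {γ : ℝ → ℂ} {γ' : ℂ} {t : ℝ} (hγ : HasDerivAt γ γ' t) (h0 : γ t ≠ 0) :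
    HasDerivAt (fun s => ‖γ s‖) (((starRingEnd ℂ) (γ t) * γ').re / ‖γ t‖) t := by
  have hn : 0 < ‖γ t‖ := norm_pos_iff.2 h0
  have h1 := hγ.norm_sq.sqrt (by positivity)
  simp only [Real.sqrt_sq (norm_nonneg _)] at h1
  convert h1 using 1
  rw [Complex.inner]
  field_simp

namespace VortexData

variable {P : VortexData}

theorem Admissible.fderiv_Ωbar (hP : P.Admissible) {X : ℂ} (hX : X ≠ 0) (v : ℂ) :
    fderiv ℝ P.Ωbar X v = deriv P.w ‖X‖ * (((starRingEnd ℂ) X * v).re / ‖X‖) := by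
  have hXn : 0 < ‖X‖ := norm_pos_iff.2 hX
  have hw : ContDiffAt ℝ ∞ P.w ‖X‖ := hP.contDiffOn_w.contDiffAt (Ioi_mem_nhds hXn)
  have hΩ : DifferentiableAt ℝ P.Ωbar X :=
    (hw.differentiableAt (by simp)).comp X ((contDiffAt_norm ℝ hX (n := 1)).differentiableAt (by simp))
  have hγ : HasDerivAt (fun t : ℝ => X + t * v) v 0 := by
    simpa using ((hasDerivAt_id (0 : ℝ)).ofReal_comp.mul_const v).const_add X
  have e0 : X + ((0 : ℝ) : ℂ) * v = X := by simp
  have h1 : HasDerivAt (fun t : ℝ => P.Ωbar (X + t * v)) (fderiv ℝ P.Ωbar X v) 0 := by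
    have hf : HasFDerivAt P.Ωbar (fderiv ℝ P.Ωbar X) (X + ((0 : ℝ) : ℂ) * v) := by
      rw [e0]; exact hΩ.hasFDerivAt
    exact hf.comp_hasDerivAt (0 : ℝ) hγ
  have h2 := hasDerivAt_norm_curve hγ (by simpa using hX)
  have h3 : HasDerivAt (fun t : ℝ => P.Ωbar (X + t * v)) (deriv P.w ‖X‖ * (((starRingEnd ℂ) X * v).re / ‖X‖)) 0 := by
    have hw' : HasDerivAt P.w (deriv P.w ‖X‖) ‖X + ((0 : ℝ) : ℂ) * v‖ := by
      rw [e0]; exact (hw.differentiableAt (by simp)).hasDerivAt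
    have := hw'.comp (0 : ℝ) h2
    rw [e0] at this
    exact this
  exact h1.unique h3

/-- The gradient of `Ω̄` points along `X`, so `V · ∇Ω̄` sees only `V · X`. -/
theorem Admissible.K_mode (hP : P.Admissible) {W : ℂ → ℂ} {g : ℝ → ℂ} {k : ℤ} (hk : 2 ≤ k.natAbs)
    (hL : MemLp W 2 volume) (hW : ∀ᵐ X : ℂ, W X = g ‖X‖ * (X / (‖X‖ : ℂ)) ^ k) :
    ∀ᵐ X : ℂ, P.K W X = -(((deriv P.w ‖X‖ : ℝ) : ℂ) / (‖X‖ : ℂ) *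
      (Complex.I * (k.sign : ℂ) / 2 * radialPot k.natAbs g ‖X‖)) * (X / (‖X‖ : ℂ)) ^ k := by
  filter_upwards [velocity_radial hk hL hW, ae_ne_zero] with X hX hX0
  rw [K, hP.fderiv_Ωbar hX0, hP.fderiv_Ωbar hX0]
  have e1 : ((starRingEnd ℂ) X * 1).re = X.re := by simp
  have e2 : ((starRingEnd ℂ) X * Complex.I).re = X.im := by simp
  rw [e1, e2]
  push_cast
  linear_combination (-((deriv P.w ‖X‖ : ℝ) : ℂ) / ‖X‖) * hX

end VortexData

/-! ### Transport of test functions of a single mode. -/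

theorem contDiffAt_unit_zpow (k : ℤ) {X : ℂ} (hX : X ≠ 0) :
    ContDiffAt ℝ ∞ (fun X : ℂ => (X / (‖X‖ : ℂ)) ^ k) X := by
  have hXn : (‖X‖ : ℂ) ≠ 0 := by simpa using hX
  have hn : ContDiffAt ℝ ∞ (fun X : ℂ => (‖X‖ : ℂ)) X :=
    Complex.ofRealCLM.contDiff.contDiffAt.comp X (contDiffAt_norm ℝ hX)
  have hu : ContDiffAt ℝ ∞ (fun X : ℂ => X / (‖X‖ : ℂ)) X := by
    simp only [div_eq_mul_inv]
    exact contDiffAt_id.mul (hn.inv hXn)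
  obtain ⟨m, rfl | rfl⟩ := k.eq_nat_or_neg
  · simp only [zpow_natCast]
    exact hu.pow m
  · simp only [zpow_neg, zpow_natCast]
    exact (hu.pow m).inv (pow_ne_zero _ (div_ne_zero hX hXn))

/-- The test function with radial profile `f` and mode `k`. -/
noncomputable def modeFun (f : ℝ → ℂ) (k : ℤ) (X : ℂ) : ℂ := f ‖X‖ * (X / (‖X‖ : ℂ)) ^ k

theorem contDiffAt_modeFun {f : ℝ → ℂ} (k : ℤ) {X : ℂ} (hX : X ≠ 0) (hf : ContDiffAt ℝ ∞ f ‖X‖) :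
    ContDiffAt ℝ ∞ (modeFun f k) X :=
  (hf.comp X (contDiffAt_norm ℝ hX)).mul (contDiffAt_unit_zpow k hX)

theorem contDiff_modeFun {f : ℝ → ℂ} (k : ℤ) (hf : ContDiff ℝ ∞ f)
    (hs : tsupport f ⊆ Set.Ioi 0) : ContDiff ℝ ∞ (modeFun f k) := by
  rw [contDiff_iff_contDiffAt]
  intro X
  rcases eq_or_ne X 0 with rfl | hX
  · have h0 : (0 : ℝ) ∉ tsupport f := fun h => lt_irrefl (0 : ℝ) (hs h)
    have h1 : f =ᶠ[𝓝 0] 0 := notMem_tsupport_iff_eventuallyEq.1 h0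
    have h2 : Tendsto (fun X : ℂ => ‖X‖) (𝓝 0) (𝓝 0) := by simpa using (continuous_norm (E := ℂ)).tendsto 0
    have h3 : modeFun f k =ᶠ[𝓝 0] fun _ => 0 := by
      filter_upwards [h2.eventually h1] with X hX
      simp [modeFun, hX]
    exact contDiffAt_const.congr_of_eventuallyEq h3
  · exact contDiffAt_modeFun k hX hf.contDiffAt

theorem hasCompactSupport_modeFun {f : ℝ → ℂ} (k : ℤ) {M : ℝ} (hf : ∀ r, M < r → f r = 0) :
    HasCompactSupport (modeFun f k) := by
  refine HasCompactSupport.intro (isCompact_closedBall (0 : ℂ) M) fun X hX => ?_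
  rw [mem_closedBall_zero_iff, not_le] at hX
  simp [modeFun, hf _ hX]

theorem VortexData.Vb_eq (P : VortexData) (b : ℝ) {X : ℂ} (hX : X ≠ 0) :
    P.Vb b X = X * (Complex.I * ((P.vθ ‖X‖ / ‖X‖ : ℝ) : ℂ) - b) := by
  have hXn : (‖X‖ : ℂ) ≠ 0 := by simpa using hX
  rw [Vb, Vbar]
  push_cast
  field_simp

/-- The direction `X (iα - b)` is the initial velocity of the logarithmic spiral `X exp (t (iα -
b))`, along which the modulus scales by `e^{-bt}` and the phase rotates by `αt`. -/
theorem fderiv_modeFun {f : ℝ → ℂ} (k : ℤ) {X : ℂ} (hX : X ≠ 0) (hf : ContDiffAt ℝ ∞ f ‖X‖)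
    (α b : ℝ) : fderiv ℝ (modeFun f k) X (X * (Complex.I * α - b)) =
      (-b * ‖X‖ * deriv f ‖X‖ + Complex.I * k * α * f ‖X‖) * (X / (‖X‖ : ℂ)) ^ k := by
  have hXn : 0 < ‖X‖ := norm_pos_iff.2 hX
  set γ : ℝ → ℂ := fun t => X * Complex.exp (t * (Complex.I * α - b))
  have hγ : HasDerivAt γ (X * (Complex.I * α - b)) 0 := by
    have h1 : HasDerivAt (fun t : ℝ => (t : ℂ) * (Complex.I * α - b)) (Complex.I * α - b) 0 := by
      simpa using (hasDerivAt_id (0 : ℝ)).ofReal_comp.mul_const (Complex.I * α - b)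
    simpa using h1.cexp.const_mul X
  have e0 : γ 0 = X := by simp [γ]
  have h1 : HasDerivAt (fun t : ℝ => modeFun f k (γ t))
      (fderiv ℝ (modeFun f k) X (X * (Complex.I * α - b))) 0 := by
    have hF : HasFDerivAt (modeFun f k) (fderiv ℝ (modeFun f k) X) (γ 0) := by
      rw [e0]; exact ((contDiffAt_modeFun k hX hf).differentiableAt (by simp)).hasFDerivAt
    exact hF.comp_hasDerivAt (0 : ℝ) hγ
  have hnorm : ∀ t, ‖γ t‖ = ‖X‖ * Real.exp (-b * t) := by
    intro t
    simp only [γ, norm_mul, Complex.norm_exp]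
    congr 2
    simp
    ring
  have e1 : ∀ t, modeFun f k (γ t) = f (‖X‖ * Real.exp (-b * t)) *
      ((X / (‖X‖ : ℂ)) ^ k * Complex.exp (t * (Complex.I * k * α))) := by
    intro t
    rw [modeFun, hnorm]
    congr 1
    have : γ t / ((‖X‖ * Real.exp (-b * t) : ℝ) : ℂ) = X / ‖X‖ * Complex.exp (t * (Complex.I * α)) := by
      have hne : (‖X‖ : ℂ) ≠ 0 := by simpa using hX
      push_cast
      have : Complex.exp (t * (Complex.I * α - b)) = Complex.exp (t * (Complex.I * α)) * Complex.exp (-b * t) := by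
        rw [← Complex.exp_add]; congr 1; ring
      simp only [γ]
      rw [this]
      have := Complex.exp_ne_zero (-b * t)
      field_simp
    rw [this, mul_zpow, ← Complex.exp_int_mul]
    congr 2
    ring
  have h2 : HasDerivAt (fun t : ℝ => f (‖X‖ * Real.exp (-b * t)) *
      ((X / (‖X‖ : ℂ)) ^ k * Complex.exp (t * (Complex.I * k * α))))
      ((-b * ‖X‖ * deriv f ‖X‖ + Complex.I * k * α * f ‖X‖) * (X / (‖X‖ : ℂ)) ^ k) 0 := by
    have h3 : HasDerivAt (fun t : ℝ => ‖X‖ * Real.exp (-b * t)) (‖X‖ * (-b)) 0 := by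
      have := (((hasDerivAt_id (0 : ℝ)).const_mul (-b)).exp).const_mul ‖X‖
      simpa using this
    have h4 : HasDerivAt f (deriv f ‖X‖) (‖X‖ * Real.exp (-b * 0)) := by
      simpa using (hf.differentiableAt (by simp)).hasDerivAt
    have h5 : HasDerivAt (fun t : ℝ => Complex.exp (t * (Complex.I * k * α))) (Complex.I * k * α) 0 := by
      have h1 : HasDerivAt (fun t : ℝ => (t : ℂ) * (Complex.I * k * α)) (Complex.I * k * α) 0 := by
        simpa using (hasDerivAt_id (0 : ℝ)).ofReal_comp.mul_const (Complex.I * k * α)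
      simpa using h1.cexp
    have h6 := (h4.scomp (0 : ℝ) h3).mul (h5.const_mul ((X / (‖X‖ : ℂ)) ^ k))
    refine HasDerivAt.congr_deriv h6 ?_
    simp
    ring
  simp only [e1] at h1
  exact h1.unique h2

/-! ### Primitives and weak derivatives on the half line -/

/-- Real test functions on `(0, ∞)`. -/
structure HalfLineTest (F : ℝ → ℝ) : Prop where
  smooth : ContDiff ℝ ∞ F
  compact : HasCompactSupport F
  pos : tsupport F ⊆ Set.Ioi 0

theorem exists_Icc_of_compact {K : Set ℝ} (hK : IsCompact K) (h0 : K ⊆ Set.Ioi 0) :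
    ∃ δ M : ℝ, 0 < δ ∧ δ ≤ M ∧ K ⊆ Set.Icc δ M := by
  rcases K.eq_empty_or_nonempty with rfl | hne
  · exact ⟨1, 1, one_pos, le_rfl, Set.empty_subset _⟩
  · obtain ⟨x, hx⟩ := hK.exists_isLeast hne
    obtain ⟨y, hy⟩ := hK.exists_isGreatest hne
    exact ⟨x, y, h0 hx.1, hx.2 hy.1, fun z hz => ⟨hx.2 hz, hy.2 hz⟩⟩

theorem LocallyIntegrableOn.intervalIntegrable_pos {p : ℝ → ℂ} (hp : LocallyIntegrableOn p (Set.Ioi 0))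
    {a b : ℝ} (ha : 0 < a) (hb : 0 < b) : IntervalIntegrable p volume a b := by
  rw [intervalIntegrable_iff']
  apply hp.integrableOn_compact_subset _ isCompact_uIcc
  intro x hx
  exact (lt_min ha hb).trans_le hx.1

theorem continuousOn_primitive_pos {p : ℝ → ℂ} (hp : LocallyIntegrableOn p (Set.Ioi 0)) :
    ContinuousOn (fun x => ∫ t in (1 : ℝ)..x, p t) (Set.Ioi 0) := by
  intro x hx
  have hx0 : 0 < x := hx
  set a := min 1 x / 2 with ha
  set b := max 1 x + 1 with hb
  have hm : 0 < min 1 x := lt_min one_pos hx0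
  have ha0 : 0 < a := by positivity
  have h1a : a < 1 := by rw [ha]; linarith [min_le_left 1 x]
  have hxa : a < x := by rw [ha]; linarith [min_le_right 1 x]
  have h1b : 1 < b := by rw [hb]; linarith [le_max_left 1 x]
  have hxb : x < b := by rw [hb]; linarith [le_max_right 1 x]
  have h := intervalIntegral.continuousOn_primitive_interval'
    (LocallyIntegrableOn.intervalIntegrable_pos hp ha0 (ha0.trans (hxa.trans hxb))) (a := 1)
    (by rw [Set.uIcc_of_le (h1a.trans h1b).le]; exact ⟨h1a.le, h1b.le⟩)
  rw [Set.uIcc_of_le (hxa.trans hxb).le] at h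
  exact (h.continuousAt (Icc_mem_nhds hxa hxb)).continuousWithinAt

theorem hasDerivAt_primitive_pos {S : ℝ → ℂ} (hS : ContinuousOn S (Set.Ioi 0)) {x : ℝ} (hx : 0 < x) :
    HasDerivAt (fun x => ∫ t in (1 : ℝ)..x, S t) (S x) x :=
  intervalIntegral.integral_hasDerivAt_right
    (LocallyIntegrableOn.intervalIntegrable_pos (hS.locallyIntegrableOn measurableSet_Ioi) one_pos hx)
    (hS.stronglyMeasurableAtFilter isOpen_Ioi x hx) (hS.continuousAt (Ioi_mem_nhds hx))

theorem contDiffOn_succ_of_hasDerivAt {n : ℕ} {u S : ℝ → ℂ} (hS : ContDiffOn ℝ n S (Set.Ioi 0))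
    (hu : ∀ x : ℝ, 0 < x → HasDerivAt u (S x) x) : ContDiffOn ℝ (n + 1 : ℕ) u (Set.Ioi 0) := by
  rw [Nat.cast_succ, contDiffOn_succ_iff_deriv_of_isOpen isOpen_Ioi]
  refine ⟨fun x hx => (hu x hx).differentiableAt.differentiableWithinAt, by simp, ?_⟩
  exact hS.congr fun x hx => (hu x hx).deriv

theorem HalfLineTest.deriv {F : ℝ → ℝ} (hF : HalfLineTest F) : HalfLineTest (deriv F) where
  smooth := (contDiff_infty_iff_deriv.1 hF.smooth).2
  compact := hF.compact.deriv
  pos := tsupport_deriv_subset.trans hF.pos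

theorem HalfLineTest.integrable_smul {F : ℝ → ℝ} (hF : HalfLineTest F) {p : ℝ → ℂ}
    (hp : LocallyIntegrableOn p (Set.Ioi 0)) : Integrable fun s => F s • p s := by
  have h1 : IntegrableOn (fun s => (F s : ℂ) * p s) (tsupport F) :=
    (hp.integrableOn_compact_subset hF.pos hF.compact).continuousOn_mul
      (Complex.continuous_ofReal.comp hF.smooth.continuous).continuousOn hF.compact
  simp only [Complex.real_smul]
  rwa [integrableOn_iff_integrable_of_support_subset] at h1
  intro s hs
  apply subset_tsupport
  intro h
  apply hs
  simp [h]

theorem HalfLineTest.integral_deriv_smul_primitive {F : ℝ → ℝ} (hF : HalfLineTest F) {Q S : ℝ → ℂ}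
    (hS : ContinuousOn S (Set.Ioi 0)) (hQ : ∀ x : ℝ, 0 < x → HasDerivAt Q (S x) x) :
    ∫ s, _root_.deriv F s • Q s = -∫ s, F s • S s := by
  have hQc : ContinuousOn Q (Set.Ioi 0) := fun x hx => (hQ x hx).continuousAt.continuousWithinAt
  have h1 := hF.deriv.integrable_smul (hQc.locallyIntegrableOn measurableSet_Ioi)
  have h2 := hF.integrable_smul (hS.locallyIntegrableOn measurableSet_Ioi)
  have h3 := hF.integrable_smul (hQc.locallyIntegrableOn measurableSet_Ioi)
  have hd : ∀ x, HasDerivAt (fun s => F s • Q s) (F x • S x + _root_.deriv F x • Q x) x := by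
    intro x
    by_cases hx : 0 < x
    · exact (hF.smooth.differentiable (by simp) x).hasDerivAt.smul (hQ x hx)
    · have hx' : x ∉ tsupport F := fun h => hx (hF.pos h)
      have e : F =ᶠ[𝓝 x] 0 := notMem_tsupport_iff_eventuallyEq.1 hx'
      have e2 : (fun s => F s • Q s) =ᶠ[𝓝 x] fun _ => 0 := by
        filter_upwards [e] with s hs
        simp [hs]
      have e3 : _root_.deriv F x = 0 := by rw [e.deriv_eq]; simp
      rw [e.eq_of_nhds, e3]
      simpa using (hasDerivAt_const x (0 : ℂ)).congr_of_eventuallyEq e2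
  have h4 := integral_eq_zero_of_hasDerivAt_of_integrable hd (h2.add h1) h3
  rw [integral_add h2 h1] at h4
  linear_combination h4

/-- A test function with zero integral is the derivative of a test function. -/
theorem HalfLineTest.exists_primitive {ψ : ℝ → ℝ} (hψ : HalfLineTest ψ) (h0 : ∫ x, ψ x = 0) :
    ∃ F : ℝ → ℝ, HalfLineTest F ∧ _root_.deriv F = ψ := by
  obtain ⟨δ, M, hδ, hδM, hK⟩ := exists_Icc_of_compact hψ.compact hψ.pos
  have hi : ∀ a b : ℝ, IntervalIntegrable ψ volume a b := fun a b =>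
    hψ.smooth.continuous.intervalIntegrable _ _
  have hz : ∀ x, x ∉ Set.Icc δ M → ψ x = 0 := fun x hx =>
    image_eq_zero_of_notMem_tsupport fun h => hx (hK h)
  set F : ℝ → ℝ := fun x => ∫ t in (0 : ℝ)..x, ψ t
  have hsub : Function.support F ⊆ Set.Icc δ M := by
    intro x hx
    by_contra hxn
    apply hx
    rw [Set.mem_Icc, not_and_or, not_le, not_le] at hxn
    rcases hxn with h | h
    · apply intervalIntegral.integral_zero_ae
      refine Eventually.of_forall fun t ht => hz t fun ht' => ?_
      have : t ≤ max 0 x := ht.2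
      have := max_lt hδ h
      linarith [ht'.1]
    · simp only [F]
      rw [intervalIntegral.integral_eq_integral_of_support_subset, h0]
      intro t ht
      have : t ∈ Set.Icc δ M := by
        by_contra hn
        exact ht (hz t hn)
      exact ⟨by linarith [this.1], by linarith [this.2]⟩
  have htsub : tsupport F ⊆ Set.Icc δ M := closure_minimal hsub isClosed_Icc
  refine ⟨F, ⟨contDiff_primitive hψ.smooth 0, ?_, fun x hx => hδ.trans_le (htsub hx).1⟩, ?_⟩
  · exact isCompact_Icc.of_isClosed_subset (isClosed_tsupport _) htsub
  · ext x
    exact (intervalIntegral.integral_hasDerivAt_right (hi _ _)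
      hψ.smooth.continuous.aestronglyMeasurable.stronglyMeasurableAtFilter
      hψ.smooth.continuous.continuousAt).deriv

theorem exists_halfLineTest_integral_one : ∃ ψ : ℝ → ℝ, HalfLineTest ψ ∧ ∫ x, ψ x = 1 := by
  let f : ContDiffBump (1 : ℝ) := ⟨1 / 4, 1 / 2, by norm_num, by norm_num⟩
  refine ⟨f.normed volume, ⟨f.contDiff_normed, f.hasCompactSupport_normed, ?_⟩, f.integral_normed⟩
  rw [f.tsupport_normed_eq]
  intro x hx
  rw [Metric.mem_closedBall, Real.dist_eq, abs_le] at hx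
  have : (0 : ℝ) < x := by
    have := hx.1
    have e : f.rOut = 1 / 2 := rfl
    rw [e] at this
    linarith
  exact this

/-- The lemma of du Bois-Reymond on the half line. -/
theorem ae_const_of_integral_deriv_smul_eq_zero {p : ℝ → ℂ} (hp : LocallyIntegrableOn p (Set.Ioi 0))
    (h : ∀ F, HalfLineTest F → ∫ s, deriv F s • p s = 0) :
    ∃ C : ℂ, ∀ᵐ s ∂volume.restrict (Set.Ioi 0), p s = C := by
  obtain ⟨ψ₀, hψ₀, h1⟩ := exists_halfLineTest_integral_one
  set C : ℂ := ∫ s, ψ₀ s • p s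
  refine ⟨C, ?_⟩
  have hc : LocallyIntegrableOn (fun _ : ℝ => C) (Set.Ioi 0) :=
    continuousOn_const.locallyIntegrableOn measurableSet_Ioi
  have key := isOpen_Ioi.ae_eq_zero_of_integral_contDiff_smul_eq_zero (μ := volume)
    (f := fun s => p s - C) (hp.sub hc) (fun ψ hs hcs hts => ?_)
  · rw [ae_restrict_iff' measurableSet_Ioi]
    filter_upwards [key] with s hs hs0
    exact sub_eq_zero.1 (hs hs0)
  · have hψ : HalfLineTest ψ := ⟨hs, hcs, hts⟩
    set I : ℝ := ∫ x, ψ x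
    -- Subtracting the right multiple of `ψ₀` gives integral zero, so the result is the derivative
    -- of a test function and the hypothesis applies.
    have hχ : HalfLineTest (fun x => ψ x - I * ψ₀ x) := by
      refine ⟨hs.sub (contDiff_const.mul hψ₀.smooth), hcs.sub hψ₀.compact.mul_left, ?_⟩
      have hsub : tsupport (fun x => ψ x - I * ψ₀ x) ⊆ tsupport ψ ∪ tsupport ψ₀ := by
        refine closure_minimal (fun x hx => ?_) ((isClosed_tsupport _).union (isClosed_tsupport _))
        by_contra hn
        rw [Set.mem_union, not_or] at hn
        apply hx
        simp [image_eq_zero_of_notMem_tsupport hn.1, image_eq_zero_of_notMem_tsupport hn.2]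
      exact hsub.trans (Set.union_subset hts hψ₀.pos)
    have hi0 : Integrable ψ₀ := hψ₀.smooth.continuous.integrable_of_hasCompactSupport hψ₀.compact
    have hi : Integrable ψ := hs.continuous.integrable_of_hasCompactSupport hcs
    obtain ⟨F, hF, hFd⟩ := hχ.exists_primitive (by
      rw [integral_sub hi (hi0.const_mul _), integral_const_mul, h1]; simp [I])
    have h2 := h F hF
    rw [hFd] at h2
    have e : ∫ s, (ψ s - I * ψ₀ s) • p s = (∫ s, ψ s • p s) - I * C := by
      simp only [sub_smul, mul_smul]
      rw [integral_sub (hψ.integrable_smul hp) ((hψ₀.integrable_smul hp).fun_smul I), integral_smul]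
      simp [C]
    rw [e] at h2
    simp only [smul_sub]
    rw [integral_sub (hψ.integrable_smul hp) (hψ.integrable_smul hc), integral_smul_const]
    simpa [I] using h2

/-- A function whose weak derivative is continuous is a.e. equal to a `C¹` function. -/
theorem exists_primitive_of_weak_deriv {p S : ℝ → ℂ} (hp : LocallyIntegrableOn p (Set.Ioi 0))
    (hS : ContinuousOn S (Set.Ioi 0))
    (h : ∀ F, HalfLineTest F → ∫ s, deriv F s • p s = -∫ s, F s • S s) :
    ∃ u : ℝ → ℂ, (∀ᵐ s ∂volume.restrict (Set.Ioi 0), p s = u s) ∧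
      ∀ x : ℝ, 0 < x → HasDerivAt u (S x) x := by
  set Q : ℝ → ℂ := fun x => ∫ t in (1 : ℝ)..x, S t
  have hQ : ∀ x : ℝ, 0 < x → HasDerivAt Q (S x) x := fun x hx => hasDerivAt_primitive_pos hS hx
  have hQc : ContinuousOn Q (Set.Ioi 0) := fun x hx => (hQ x hx).continuousAt.continuousWithinAt
  have hQl := hQc.locallyIntegrableOn (μ := volume) measurableSet_Ioi
  obtain ⟨C, hC⟩ := ae_const_of_integral_deriv_smul_eq_zero (hp.sub hQl) (fun F hF => by
    simp only [Pi.sub_apply, smul_sub]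
    rw [integral_sub (hF.deriv.integrable_smul hp) (hF.deriv.integrable_smul hQl), h F hF,
      hF.integral_deriv_smul_primitive hS hQ, sub_self])
  refine ⟨fun x => Q x + C, ?_, fun x hx => (hQ x hx).add_const C⟩
  filter_upwards [hC] with s hs
  rw [← hs]
  simp

/-! ### Regularity of the radial potential -/

theorem RadialL2.locallyIntegrableOn {g : ℝ → ℂ} (hg : RadialL2 g) :
    LocallyIntegrableOn g (Set.Ioi 0) := by
  rw [locallyIntegrableOn_iff isOpen_Ioi.isLocallyClosed]
  intro K hK hKc
  have := hg.integrableOn_of_sq (q := fun _ => 1) hKc.measurableSet hK measurable_const (by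
    refine ContinuousOn.integrableOn_compact hKc ?_
    refine ContinuousOn.mul ?_ continuousOn_const
    exact continuousOn_inv₀.mono fun x hx => ne_of_gt (hK hx))
  simpa using this

theorem innerPot_eq {g : ℝ → ℂ} (hg : RadialL2 g) (m : ℕ) {R : ℝ} (hR : 0 < R) :
    innerPot m g R = innerPot m g 1 + ∫ s in (1 : ℝ)..R, (s : ℂ) ^ (m + 1) * g s := by
  have h1 : IntervalIntegrable (fun s : ℝ => (s : ℂ) ^ (m + 1) * g s) volume 0 1 :=
    (intervalIntegrable_iff_integrableOn_Ioc_of_le zero_le_one).2 (hg.integrableOn_inner m 1)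
  have h2 : IntervalIntegrable (fun s : ℝ => (s : ℂ) ^ (m + 1) * g s) volume 0 R :=
    (intervalIntegrable_iff_integrableOn_Ioc_of_le hR.le).2 (hg.integrableOn_inner m R)
  rw [innerPot, innerPot, ← intervalIntegral.integral_of_le hR.le,
    ← intervalIntegral.integral_of_le zero_le_one,
    intervalIntegral.integral_add_adjacent_intervals h1 (h1.symm.trans h2)]

theorem outerPot_eq {g : ℝ → ℂ} (hg : RadialL2 g) {m : ℕ} (hm : 2 ≤ m) {R : ℝ} (hR : 0 < R) :
    outerPot m g R = outerPot m g 1 - ∫ s in (1 : ℝ)..R, (s : ℂ) * ((s : ℂ) ^ m)⁻¹ * g s := by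
  rw [outerPot, outerPot, ← intervalIntegral.integral_interval_add_Ioi
    (hg.integrableOn_outer hm one_pos) (hg.integrableOn_outer hm hR)]
  ring

theorem contDiff_ofReal_pow (j : ℕ) {n : WithTop ℕ∞} : ContDiff ℝ n (fun s : ℝ => (s : ℂ) ^ j) :=
  Complex.ofRealCLM.contDiff.pow j

theorem contDiffOn_ofReal_pow_inv (j : ℕ) {n : WithTop ℕ∞} :
    ContDiffOn ℝ n (fun s : ℝ => ((s : ℂ) ^ j)⁻¹) (Set.Ioi 0) :=
  (contDiff_ofReal_pow j).contDiffOn.inv fun x hx =>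
    pow_ne_zero _ (Complex.ofReal_ne_zero.2 (ne_of_gt hx))

theorem contDiffOn_ofReal_mul_pow_inv (j : ℕ) {n : WithTop ℕ∞} :
    ContDiffOn ℝ n (fun s : ℝ => (s : ℂ) * ((s : ℂ) ^ j)⁻¹) (Set.Ioi 0) :=
  Complex.ofRealCLM.contDiff.contDiffOn.mul (contDiffOn_ofReal_pow_inv j)

/-- Based at radius `1`, the inner and outer integrals depend on `R` only through interval integrals
inside `(0, ∞)`. -/
theorem contDiffOn_radialPot_of_primitive {g : ℝ → ℂ} (hg : RadialL2 g) {m : ℕ} (hm : 2 ≤ m)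
    {n : WithTop ℕ∞}
    (h1 : ContDiffOn ℝ n (fun R => ∫ s in (1 : ℝ)..R, (s : ℂ) ^ (m + 1) * g s) (Set.Ioi 0))
    (h2 : ContDiffOn ℝ n (fun R => ∫ s in (1 : ℝ)..R, (s : ℂ) * ((s : ℂ) ^ m)⁻¹ * g s) (Set.Ioi 0)) :
    ContDiffOn ℝ n (radialPot m g) (Set.Ioi 0) := by
  have h3 := ((contDiffOn_ofReal_pow_inv m (n := n)).mul
      ((contDiffOn_const (c := innerPot m g 1)).add h1)).add
    ((contDiff_ofReal_pow m (n := n)).contDiffOn.mul ((contDiffOn_const (c := outerPot m g 1)).sub h2))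
  refine h3.congr fun R hR => ?_
  rw [radialPot, innerPot_eq hg m hR, outerPot_eq hg hm hR]

theorem continuousOn_radialPot {g : ℝ → ℂ} (hg : RadialL2 g) {m : ℕ} (hm : 2 ≤ m) :
    ContinuousOn (radialPot m g) (Set.Ioi 0) := by
  have hl := hg.locallyIntegrableOn
  rw [← contDiffOn_zero (𝕜 := ℝ)]
  apply contDiffOn_radialPot_of_primitive hg hm
  · rw [contDiffOn_zero]
    exact continuousOn_primitive_pos (hl.continuousOn_mul (contDiff_ofReal_pow _ (n := 0)).continuous.continuousOn isOpen_Ioi.isLocallyClosed)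
  · rw [contDiffOn_zero]
    exact continuousOn_primitive_pos (hl.continuousOn_mul (contDiffOn_ofReal_mul_pow_inv m (n := 0)).continuousOn isOpen_Ioi.isLocallyClosed)

/-- `g` enters only under integrals, so regularity of an a.e. representative is enough. -/
theorem contDiffOn_radialPot {g g' : ℝ → ℂ} (hg : RadialL2 g) {m : ℕ} (hm : 2 ≤ m) {n : ℕ}
    (hgg : ∀ᵐ s ∂volume.restrict (Set.Ioi 0), g s = g' s) (hg' : ContDiffOn ℝ n g' (Set.Ioi 0)) :
    ContDiffOn ℝ n (radialPot m g) (Set.Ioi 0) := by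
  have main : ∀ q : ℝ → ℂ, ContDiffOn ℝ n q (Set.Ioi 0) →
      ContDiffOn ℝ n (fun R => ∫ s in (1 : ℝ)..R, q s * g s) (Set.Ioi 0) := by
    intro q hq
    have hqg := hq.mul hg'
    have h1 : ContDiffOn ℝ (n + 1 : ℕ) (fun R => ∫ s in (1 : ℝ)..R, q s * g' s) (Set.Ioi 0) :=
      contDiffOn_succ_of_hasDerivAt hqg fun x hx => hasDerivAt_primitive_pos hqg.continuousOn hx
    refine (h1.of_le (by exact_mod_cast Nat.le_succ n)).congr fun R hR => ?_
    apply intervalIntegral.integral_congr_ae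
    rw [ae_restrict_iff' measurableSet_Ioi] at hgg
    filter_upwards [hgg] with s hs hs1
    rw [hs ((lt_min one_pos hR).trans hs1.1)]
  exact contDiffOn_radialPot_of_primitive hg hm (main _ (contDiff_ofReal_pow _).contDiffOn)
    (main _ (contDiffOn_ofReal_mul_pow_inv m))

/-- Weak solutions of the radial integro-differential equation `(ν g)' = q h`, with `h` the radial
potential of `g`, are smooth. -/
theorem exists_smooth_of_weak_radial {g ν q : ℝ → ℂ} (hg : RadialL2 g) {m : ℕ} (hm : 2 ≤ m)
    (hν : ContDiffOn ℝ ∞ ν (Set.Ioi 0)) (hν0 : ∀ s : ℝ, 0 < s → ν s ≠ 0)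
    (hq : ContDiffOn ℝ ∞ q (Set.Ioi 0))
    (h : ∀ F, HalfLineTest F →
      ∫ s, deriv F s • (ν s * g s) = -∫ s, F s • (q s * radialPot m g s)) :
    ∃ u : ℝ → ℂ, (∀ᵐ s ∂volume.restrict (Set.Ioi 0), g s = u s / ν s) ∧
      ContDiffOn ℝ ∞ u (Set.Ioi 0) ∧
      ∀ s : ℝ, 0 < s → HasDerivAt u (q s * radialPot m g s) s := by
  have hS : ContinuousOn (fun s => q s * radialPot m g s) (Set.Ioi 0) :=
    hq.continuousOn.mul (continuousOn_radialPot hg hm)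
  obtain ⟨u, hu, hd⟩ := exists_primitive_of_weak_deriv
    (hg.locallyIntegrableOn.continuousOn_mul hν.continuousOn isOpen_Ioi.isLocallyClosed) hS h
  have hgu : ∀ᵐ s ∂volume.restrict (Set.Ioi 0), g s = u s / ν s := by
    filter_upwards [hu, ae_restrict_mem measurableSet_Ioi] with s hs hs0
    rw [← hs, mul_div_cancel_left₀ _ (hν0 s hs0)]
  refine ⟨u, hgu, ?_, hd⟩
  rw [contDiffOn_infty]
  intro n
  -- If `u` is `C^n`, so are `u / ν`, its potential and `u' = q h`; hence `u` is `C^{n+1}`.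
  induction n with
  | zero =>
    rw [Nat.cast_zero, contDiffOn_zero]
    exact fun x hx => (hd x hx).continuousAt.continuousWithinAt
  | succ n ih =>
    have hn : ((n : ℕ∞) : WithTop ℕ∞) ≤ ∞ := by exact_mod_cast le_top
    refine contDiffOn_succ_of_hasDerivAt ((hq.of_le hn).mul ?_) hd
    refine contDiffOn_radialPot hg hm hgu ?_
    simp only [div_eq_mul_inv]
    exact ih.mul ((hν.of_le hn).inv fun x hx => hν0 x hx)

/-! ### The integrating factor -/

/-- The exponential of the primitive of `A` vanishing at `1`. -/
noncomputable def expPrimitive (A : ℝ → ℂ) (s : ℝ) : ℂ := Complex.exp (∫ t in (1 : ℝ)..s, A t)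

theorem expPrimitive_ne_zero (A : ℝ → ℂ) (s : ℝ) : expPrimitive A s ≠ 0 := Complex.exp_ne_zero _

theorem hasDerivAt_expPrimitive {A : ℝ → ℂ} (hA : ContinuousOn A (Set.Ioi 0)) {s : ℝ} (hs : 0 < s) :
    HasDerivAt (expPrimitive A) (expPrimitive A s * A s) s :=
  (hasDerivAt_primitive_pos hA hs).cexp

theorem contDiffOn_expPrimitive {A : ℝ → ℂ} (hA : ContDiffOn ℝ ∞ A (Set.Ioi 0)) :
    ContDiffOn ℝ ∞ (expPrimitive A) (Set.Ioi 0) := by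
  refine ContDiffOn.cexp ?_
  rw [contDiffOn_infty] at hA ⊢
  intro n
  exact (contDiffOn_succ_of_hasDerivAt (hA n) fun x hx =>
    hasDerivAt_primitive_pos (hA n).continuousOn hx).of_le (by exact_mod_cast Nat.le_succ n)

/-- The primitive of `ζ / t` is `ζ log t`: where the rate is scale invariant, the integrating factor
is a pure power. -/
theorem expPrimitive_of_eq_div {A : ℝ → ℂ} (hA : ContinuousOn A (Set.Ioi 0)) {ζ : ℂ} {x y : ℝ}
    (hx : 0 < x) (hxy : x ≤ y) (h : ∀ t ∈ Set.Icc x y, A t = ζ / t) :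
    expPrimitive A y = expPrimitive A x * ((y / x : ℝ) : ℂ) ^ ζ := by
  have hy : 0 < y := hx.trans_le hxy
  have hl := hA.locallyIntegrableOn (μ := volume) measurableSet_Ioi
  have h1 : ∫ t in x..y, A t = ζ * Real.log (y / x) := by
    have e : ∫ t in x..y, A t = ∫ t in x..y, ζ * ((1 / t : ℝ) : ℂ) := by
      apply intervalIntegral.integral_congr
      intro t ht
      rw [Set.uIcc_of_le hxy] at ht
      simp only
      rw [h t ht]
      push_cast
      ring
    rw [e, intervalIntegral.integral_const_mul, intervalIntegral.integral_ofReal,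
      integral_one_div_of_pos hx hy]
  have h2 := intervalIntegral.integral_add_adjacent_intervals
    (LocallyIntegrableOn.intervalIntegrable_pos hl one_pos hx)
    (LocallyIntegrableOn.intervalIntegrable_pos hl hx hy)
  have hq : ((y / x : ℝ) : ℂ) ≠ 0 := Complex.ofReal_ne_zero.2 (div_pos hy hx).ne'
  rw [expPrimitive, expPrimitive, ← h2, Complex.exp_add, h1, Complex.cpow_def_of_ne_zero hq,
    ← Complex.ofReal_log (div_pos hy hx).le, mul_comm ζ]

/-- `F` vanishes near every nonpositive point, so `μ` may be singular at the origin. -/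
theorem HalfLineTest.mul_smooth {F : ℝ → ℝ} (hF : HalfLineTest F) {μ : ℝ → ℂ}
    (hμ : ContDiffOn ℝ ∞ μ (Set.Ioi 0)) : ContDiff ℝ ∞ (fun s => (F s : ℂ) * μ s) ∧
      tsupport (fun s => (F s : ℂ) * μ s) ⊆ tsupport F := by
  refine ⟨?_, ?_⟩
  · rw [contDiff_iff_contDiffAt]
    intro x
    by_cases hx : 0 < x
    · exact (Complex.ofRealCLM.contDiff.comp hF.smooth).contDiffAt.mul
        (hμ.contDiffAt (Ioi_mem_nhds hx))
    · have hx' : x ∉ tsupport F := fun h => hx (hF.pos h)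
      have e : F =ᶠ[𝓝 x] 0 := notMem_tsupport_iff_eventuallyEq.1 hx'
      have e2 : (fun s => (F s : ℂ) * μ s) =ᶠ[𝓝 x] fun _ => 0 := by
        filter_upwards [e] with s hs
        simp [hs]
      exact contDiffAt_const.congr_of_eventuallyEq e2
  · refine closure_mono fun s hs h => hs ?_
    simp [h]

theorem HalfLineTest.integral_eq_Ioi {F : ℝ → ℝ} (hF : HalfLineTest F) (p : ℝ → ℂ) :
    ∫ s in Set.Ioi 0, F s • p s = ∫ s, F s • p s := by
  apply setIntegral_eq_integral_of_forall_compl_eq_zero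
  intro s hs
  rw [image_eq_zero_of_notMem_tsupport fun h => hs (hF.pos h), zero_smul]

/-! ### The radial eigenvalue equation. -/

namespace VortexData

variable {P : VortexData}

/-- The logarithmic derivative of the integrating factor of the radial transport equation. -/
noncomputable def transportRate (P : VortexData) (a b : ℝ) (lam : ℂ) (k : ℤ) (s : ℝ) : ℂ :=
  ((a * b - 2 * b - lam) - Complex.I * k * ((P.vθ s / s : ℝ) : ℂ)) / (b * s)

theorem Admissible.contDiffOn_transportRate (hP : P.Admissible) (a : ℝ) {b : ℝ} (hb : 0 < b) (lam : ℂ)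
    (k : ℤ) : ContDiffOn ℝ ∞ (P.transportRate a b lam k) (Set.Ioi 0) := by
  have h1 : ContDiffOn ℝ ∞ (fun s : ℝ => ((P.vθ s / s : ℝ) : ℂ)) (Set.Ioi 0) :=
    Complex.ofRealCLM.contDiff.comp_contDiffOn
      (hP.contDiffOn_vθ.div contDiffOn_id fun x hx => ne_of_gt hx)
  have h2 : ContDiffOn ℝ ∞ (fun s : ℝ => ((b : ℂ) * s)⁻¹) (Set.Ioi 0) := by
    refine (contDiff_const.mul Complex.ofRealCLM.contDiff).contDiffOn.inv fun x hx => ?_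
    exact mul_ne_zero (Complex.ofReal_ne_zero.2 hb.ne') (Complex.ofReal_ne_zero.2 (ne_of_gt hx))
  unfold transportRate
  simp only [div_eq_mul_inv _ ((b : ℂ) * _)]
  exact (contDiffOn_const.sub (contDiffOn_const.mul h1)).mul h2

/-- The radial form of the eigenvalue equation, in the weak sense. -/
theorem Admissible.weak_radial (hP : P.Admissible) {a b : ℝ} (hb : 0 < b) {lam : ℂ} {k : ℤ}
    (hk : 2 ≤ k.natAbs) {W D : ℂ → ℂ} {g : ℝ → ℂ} (hL : MemLp W 2 volume)
    (hW : ∀ᵐ X : ℂ, W X = g ‖X‖ * (X / (‖X‖ : ℂ)) ^ k) (hD : IsWeakDiv (P.Vb b) W D)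
    (hE : ∀ᵐ X : ℂ, (a * b : ℂ) * W X + -(D X + 2 * (b : ℂ) * W X) + P.K W X = lam * W X)
    {F : ℝ → ℝ} (hF : HalfLineTest F) :
    ∫ s, deriv F s • (((s : ℂ) ^ 2 * expPrimitive (P.transportRate a b lam k) s) * g s) =
      -∫ s, F s • (((deriv P.w s : ℝ) : ℂ) * (Complex.I * (k.sign : ℂ) / (2 * b)) *
        expPrimitive (P.transportRate a b lam k) s * radialPot k.natAbs g s) := by
  set A := P.transportRate a b lam k
  have hA : ContDiffOn ℝ ∞ A (Set.Ioi 0) := hP.contDiffOn_transportRate a hb lam k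
  set μ := expPrimitive A
  have hμ : ContDiffOn ℝ ∞ μ (Set.Ioi 0) := contDiffOn_expPrimitive hA
  have hg := RadialL2.of_memLp hL hW
  have hbc : (b : ℂ) ≠ 0 := Complex.ofReal_ne_zero.2 hb.ne'
  set f : ℝ → ℂ := fun s => (F s : ℂ) * μ s
  obtain ⟨hfs, hfsupp⟩ := hF.mul_smooth hμ
  obtain ⟨δ, M, -, -, hK⟩ := exists_Icc_of_compact hF.compact hF.pos
  have hfM : ∀ r, M < r → f r = 0 := by
    intro r hr
    have : r ∉ tsupport F := fun h => by linarith [(hK h).2]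
    simp [f, image_eq_zero_of_notMem_tsupport this]
  have hfd : ∀ s : ℝ, 0 < s → deriv f s = ((deriv F s : ℝ) : ℂ) * μ s + F s * (μ s * A s) := by
    intro s hs
    have h1 : HasDerivAt (fun s => (F s : ℂ)) ((deriv F s : ℝ) : ℂ) s :=
      (hF.smooth.differentiable (by simp) s).hasDerivAt.ofReal_comp
    exact (h1.mul (hasDerivAt_expPrimitive hA.continuousOn hs)).deriv
  have hu : ∀ X : ℂ, X ≠ 0 → (X / (‖X‖ : ℂ)) ^ k * (X / (‖X‖ : ℂ)) ^ (-k) = 1 := by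
    intro X hX
    rw [zpow_neg, mul_inv_cancel₀]
    rw [← norm_ne_zero_iff, norm_unit_zpow hX]; exact one_ne_zero
  -- The test function has the opposite mode, so the phases cancel and both integrands become
  -- radial.
  have hw := hD (modeFun f (-k)) (contDiff_modeFun _ hfs (hfsupp.trans hF.pos))
    (hasCompactSupport_modeFun _ hfM)
  have hl : ∫ X, W X * fderiv ℝ (modeFun f (-k)) X (P.Vb b X) =
      2 * Real.pi * ∫ r in Set.Ioi (0 : ℝ),
        r * (g r * (-b * r * deriv f r - Complex.I * k * ((P.vθ r / r : ℝ) : ℂ) * f r)) := by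
    refine (integral_congr_ae ?_).trans (integral_radial _)
    filter_upwards [hW, ae_ne_zero] with X hX hX0
    rw [P.Vb_eq b hX0, fderiv_modeFun _ hX0 hfs.contDiffAt, hX]
    push_cast
    linear_combination (g ‖X‖ * (-b * ‖X‖ * deriv f ‖X‖ - Complex.I * k * (P.vθ ‖X‖ / ‖X‖) * f ‖X‖)) * hu X hX0
  have hr : ∫ X, D X * modeFun f (-k) X =
      2 * Real.pi * ∫ r in Set.Ioi (0 : ℝ),
        r * (((a * b - 2 * b - lam) * g r - ((deriv P.w r : ℝ) : ℂ) / r *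
        (Complex.I * (k.sign : ℂ) / 2 * radialPot k.natAbs g r)) * f r) := by
    refine (integral_congr_ae ?_).trans (integral_radial _)
    filter_upwards [hW, ae_ne_zero, hE, hP.K_mode hk hL hW] with X hX hX0 hEX hKX
    have hDX : D X = (a * b - 2 * b - lam) * W X + P.K W X := by linear_combination -hEX
    rw [hDX, hKX, hX, modeFun]
    linear_combination (((a * b - 2 * b - lam) * g ‖X‖ - ((deriv P.w ‖X‖ : ℝ) : ℂ) / ‖X‖ *
        (Complex.I * (k.sign : ℂ) / 2 * radialPot k.natAbs g ‖X‖)) * f ‖X‖) * hu X hX0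
  rw [hl, hr] at hw
  have hpi : (2 * Real.pi : ℂ) ≠ 0 := by exact_mod_cast Real.two_pi_pos.ne'
  rw [← mul_neg] at hw
  have hw2 := mul_left_cancel₀ hpi hw
  have hlg := hg.locallyIntegrableOn
  have hν : ContinuousOn (fun s : ℝ => (s : ℂ) ^ 2 * μ s) (Set.Ioi 0) :=
    (contDiff_ofReal_pow 2 (n := 0)).continuous.continuousOn.mul hμ.continuousOn
  have hν1 : ContinuousOn (fun s : ℝ => (s : ℂ) * μ s) (Set.Ioi 0) :=
    Complex.continuous_ofReal.continuousOn.mul hμ.continuousOn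
  have hi1 := (hF.deriv.integrable_smul (hlg.continuousOn_mul hν isOpen_Ioi.isLocallyClosed)).integrableOn (s := Set.Ioi 0)
  have hi2 := (hF.integrable_smul (hlg.continuousOn_mul hν1 isOpen_Ioi.isLocallyClosed)).integrableOn (s := Set.Ioi 0)
  have hw' : ContinuousOn (fun s => ((deriv P.w s : ℝ) : ℂ)) (Set.Ioi 0) :=
    Complex.continuous_ofReal.comp_continuousOn
      (hP.contDiffOn_w.deriv_of_isOpen (m := 0) isOpen_Ioi (by simp)).continuousOn
  have hS : ContinuousOn (fun s => ((deriv P.w s : ℝ) : ℂ) * (Complex.I * (k.sign : ℂ) / (2 * b)) *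
        μ s * radialPot k.natAbs g s) (Set.Ioi 0) :=
    ((hw'.mul continuousOn_const).mul hμ.continuousOn).mul (continuousOn_radialPot hg hk)
  have hi3 := (hF.integrable_smul (hS.locallyIntegrableOn measurableSet_Ioi)).integrableOn (s := Set.Ioi 0)
  -- Since `b s A = (ab - 2b - lam) - i k V̄_θ / s`, the rotation terms cancel. The remaining term
  -- without a derivative of `F` equals the one on the other side of the equation.
  have e1 : ∫ s in Set.Ioi (0 : ℝ), (s : ℂ) * (g s * (-b * s * deriv f s - Complex.I * k * ((P.vθ s / s : ℝ) : ℂ) * f s)) =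
      ∫ s in Set.Ioi (0 : ℝ), ((-b : ℂ) * (deriv F s • ((s : ℂ) ^ 2 * μ s * g s)) -
        (a * b - 2 * b - lam) * (F s • ((s : ℂ) * μ s * g s))) := by
    apply setIntegral_congr_fun measurableSet_Ioi
    intro s hs
    have hs0 : (s : ℂ) ≠ 0 := Complex.ofReal_ne_zero.2 (ne_of_gt hs)
    simp only [Complex.real_smul]
    rw [hfd s hs]
    simp only [A, transportRate, f]
    field_simp
    ring
  have e2 : ∫ s in Set.Ioi (0 : ℝ), (s : ℂ) * (((a * b - 2 * b - lam) * g s - ((deriv P.w s : ℝ) : ℂ) / s *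
        (Complex.I * (k.sign : ℂ) / 2 * radialPot k.natAbs g s)) * f s) =
      ∫ s in Set.Ioi (0 : ℝ), ((a * b - 2 * b - lam) * (F s • ((s : ℂ) * μ s * g s)) -
        (b : ℂ) * (F s • (((deriv P.w s : ℝ) : ℂ) * (Complex.I * (k.sign : ℂ) / (2 * b)) *
        μ s * radialPot k.natAbs g s))) := by
    apply setIntegral_congr_fun measurableSet_Ioi
    intro s hs
    have hs0 : (s : ℂ) ≠ 0 := Complex.ofReal_ne_zero.2 (ne_of_gt hs)
    simp only [Complex.real_smul, f]
    field_simp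
  rw [e1, e2, integral_sub (hi1.const_mul _) (hi2.const_mul _), integral_sub (hi2.const_mul _) (hi3.const_mul _),
    integral_const_mul, integral_const_mul, integral_const_mul, hF.deriv.integral_eq_Ioi,
    hF.integral_eq_Ioi, hF.integral_eq_Ioi] at hw2
  apply mul_left_cancel₀ hbc
  linear_combination -hw2

/-- The profile of an eigenfunction: smooth on the half line, vanishing far away, homogeneous near
the origin. -/
theorem Admissible.exists_profile (hP : P.Admissible) {a b : ℝ} (hb : 0 < b) {lam : ℂ} {k : ℤ}
    (hk : 2 ≤ k.natAbs) (hγ : 0 ≤ lam.re / b - a) {W D : ℂ → ℂ} {g : ℝ → ℂ} (hL : MemLp W 2 volume)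
    (hW : ∀ᵐ X : ℂ, W X = g ‖X‖ * (X / (‖X‖ : ℂ)) ^ k) (hD : IsWeakDiv (P.Vb b) W D)
    (hE : ∀ᵐ X : ℂ, (a * b : ℂ) * W X + -(D X + 2 * (b : ℂ) * W X) + P.K W X = lam * W X) :
    ∃ (G : ℝ → ℂ) (z : ℂ), z.re = lam.re / b - a ∧
      (∀ᵐ s ∂volume.restrict (Set.Ioi 0), G s = g s) ∧ ContDiffOn ℝ ∞ G (Set.Ioi 0) ∧
      (∀ s, P.r₂ + P.ε < s → G s = 0) ∧
      ∀ s t : ℝ, 0 < s → s < P.r₁ - P.ε → 0 < t → t ≤ 1 → G (t * s) = (t : ℂ) ^ z * G s := by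
  have hg := RadialL2.of_memLp hL hW
  set A := P.transportRate a b lam k with hAdef
  have hA : ContDiffOn ℝ ∞ A (Set.Ioi 0) := hP.contDiffOn_transportRate a hb lam k
  set μ := expPrimitive A
  have hμ : ContDiffOn ℝ ∞ μ (Set.Ioi 0) := contDiffOn_expPrimitive hA
  have hbc : (b : ℂ) ≠ 0 := Complex.ofReal_ne_zero.2 hb.ne'
  set ν : ℝ → ℂ := fun s => (s : ℂ) ^ 2 * μ s with hνdef
  have hν : ContDiffOn ℝ ∞ ν (Set.Ioi 0) := (contDiff_ofReal_pow 2).contDiffOn.mul hμ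
  have hν0 : ∀ s : ℝ, 0 < s → ν s ≠ 0 := fun s hs =>
    mul_ne_zero (pow_ne_zero _ (Complex.ofReal_ne_zero.2 hs.ne')) (expPrimitive_ne_zero _ _)
  set q : ℝ → ℂ := fun s => ((deriv P.w s : ℝ) : ℂ) * (Complex.I * (k.sign : ℂ) / (2 * b)) * μ s with hqdef
  have hw' : ContDiffOn ℝ ∞ (fun s => ((deriv P.w s : ℝ) : ℂ)) (Set.Ioi 0) :=
    Complex.ofRealCLM.contDiff.comp_contDiffOn (hP.contDiffOn_w.deriv_of_isOpen isOpen_Ioi (by simp))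
  have hq : ContDiffOn ℝ ∞ q (Set.Ioi 0) := (hw'.mul contDiffOn_const).mul hμ
  obtain ⟨u, hgu, husm, hud⟩ := exists_smooth_of_weak_radial hg hk hν hν0 hq
    (fun F hF => hP.weak_radial hb hk hL hW hD hE hF)
  have hε := hP.ε_pos
  have hεr := hP.ε_lt_r₁
  have hr12 := hP.r₁_lt_r₂
  have hr1 := hP.r₁_pos
  -- `u' = q h`, and `q` contains the factor `deriv P.w`, which vanishes here.
  obtain ⟨B, hB⟩ : ∃ B, ∀ s ∈ Set.Ioi (P.r₂ + P.ε), u s = B := by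
    refine isOpen_Ioi.exists_is_const_of_deriv_eq_zero isPreconnected_Ioi (fun s hs => ?_) (fun s hs => ?_)
    · exact (hud s (lt_trans (by linarith) hs)).differentiableAt.differentiableWithinAt
    · rw [(hud s (lt_trans (by linarith) hs)).deriv, hqdef]
      simp only [hP.deriv_w_outer hs]
      simp
  obtain ⟨B₀, hB₀⟩ : ∃ B, ∀ s ∈ Set.Ioo 0 (P.r₁ - P.ε), u s = B := by
    refine isOpen_Ioo.exists_is_const_of_deriv_eq_zero isPreconnected_Ioo (fun s hs => ?_) (fun s hs => ?_)
    · exact (hud s hs.1).differentiableAt.differentiableWithinAt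
    · rw [(hud s hs.1).deriv, hqdef]
      simp only [hP.deriv_w_inner hs.1 hs.2]
      simp
  set ζ : ℂ := (a * b - 2 * b - lam) / b with hζ
  have hζre : ζ.re = -(lam.re / b - a) - 2 := by
    have : ζ = a - 2 - lam / b := by rw [hζ]; field_simp
    rw [this]
    simp only [Complex.sub_re, Complex.ofReal_re, Complex.div_ofReal_re, Complex.re_ofNat]
    ring
  -- The added `1` ensures `s > 1` beyond `r`, so that `κ² ≤ ‖g‖²` implies `κ² ≤ s ‖g‖²`.
  set r := P.r₂ + P.ε + 1 with hr
  have hr0 : 1 < r := by linarith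
  have hA1 : ∀ t, P.r₂ + P.ε ≤ t → A t = ζ / t := by
    intro t ht
    simp only [hAdef, transportRate, hP.vθ_outer ht]
    simp
    rw [hζ, div_div]
  -- Beyond `r`, `‖ν s‖` is a multiple of `s^{-γ}` and hence bounded as `γ ≥ 0`. If `B ≠ 0`, then
  -- `‖g‖ ≥ κ > 0` on a half line, contradicting square integrability.
  have hB0 : B = 0 := by
    by_contra hBne
    set κ : ℝ := ‖B‖ / (‖μ r‖ * r ^ 2)
    have hκ : 0 < κ := by
      have h1 : 0 < ‖B‖ := norm_pos_iff.2 hBne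
      have h2 : 0 < ‖μ r‖ := norm_pos_iff.2 (expPrimitive_ne_zero _ _)
      positivity
    have hlow : ∀ s, r < s → κ ≤ ‖u s / ν s‖ := by
      intro s hs
      have hsr : 1 < s / r := by rw [one_lt_div (by linarith)]; exact hs
      rw [hB s (show P.r₂ + P.ε < s by linarith), norm_div, hνdef]
      simp only
      have h1 : μ s = μ r * ((s / r : ℝ) : ℂ) ^ ζ := expPrimitive_of_eq_div hA.continuousOn (by linarith) hs.le
        fun t ht => hA1 t (by linarith [ht.1])
      rw [h1, norm_mul, norm_mul, norm_pow, Complex.norm_real, Real.norm_of_nonneg (by linarith),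
        Complex.norm_cpow_eq_rpow_re_of_pos (by linarith), hζre]
      have h2 : 0 < ‖μ r‖ := norm_pos_iff.2 (expPrimitive_ne_zero _ _)
      have h3 : (s / r) ^ (-(lam.re / b - a) - 2) ≤ (s / r) ^ (-2 : ℝ) :=
        Real.rpow_le_rpow_of_exponent_le hsr.le (by linarith)
      have h5 : (s / r) ^ (-2 : ℝ) = r ^ 2 / s ^ 2 := by
        rw [Real.rpow_neg (by linarith)]
        norm_num [div_pow]
      have h4 : 0 < (s / r) ^ (-(lam.re / b - a) - 2) := Real.rpow_pos_of_pos (by linarith) _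
      have hs2 : 0 < s ^ 2 := by nlinarith
      have hs0 : s ≠ 0 := by linarith
      apply div_le_div_of_nonneg_left (norm_nonneg _) (by positivity)
      calc s ^ 2 * (‖μ r‖ * (s / r) ^ (-(lam.re / b - a) - 2)) ≤ s ^ 2 * (‖μ r‖ * (r ^ 2 / s ^ 2)) := by
            rw [← h5]; gcongr
        _ = ‖μ r‖ * r ^ 2 := by field_simp
    have hint : IntegrableOn (fun _ : ℝ => κ ^ 2) (Set.Ioi r) := by
      have hsub : Set.Ioi r ⊆ Set.Ioi 0 := Set.Ioi_subset_Ioi (by linarith)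
      refine (hg.sq.mono_set hsub).mono' (by fun_prop) ?_
      filter_upwards [ae_restrict_mem measurableSet_Ioi, ae_restrict_of_ae_restrict_of_subset hsub hgu] with s hs hgs
      have hs' : r < s := hs
      rw [Real.norm_of_nonneg (by positivity), hgs]
      have := hlow s hs
      have h2 : κ ^ 2 ≤ ‖u s / ν s‖ ^ 2 := by gcongr
      have h3 : 0 ≤ ‖u s / ν s‖ ^ 2 := by positivity
      nlinarith
    rw [integrableOn_const_iff] at hint
    rcases hint with h | h
    · exact absurd h (by simpa using hκ.ne')
    · simp at h
  -- In the core the angular velocity `V̄_θ / s` is the constant `c / 2`, so the rate is again a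
  -- multiple of `1 / t`.
  set ζ' : ℂ := (a * b - 2 * b - lam - Complex.I * k * ((P.c / 2 : ℝ) : ℂ)) / b with hζ'
  have hA2 : ∀ t, 0 < t → t ≤ P.r₁ - P.ε → A t = ζ' / t := by
    intro t ht0 ht
    have e : P.vθ t / t = P.c / 2 := by rw [hP.vθ_inner ht]; field_simp
    simp only [hAdef, transportRate, e]
    rw [hζ', div_div]
  -- With `u` constant in the core, `G` is a multiple of `1 / ν`: the `-2` comes from the weight
  -- `s²` and `-ζ'` from `μ`.
  refine ⟨fun s => u s / ν s, -2 - ζ', ?_, ?_, ?_, ?_, ?_⟩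
  · have : -2 - ζ' = lam / b - a + Complex.I * ((k * (P.c / 2) / b : ℝ) : ℂ) := by
      rw [hζ']; push_cast; field_simp; ring
    rw [this]
    simp only [Complex.add_re, Complex.sub_re, Complex.ofReal_re, Complex.div_ofReal_re, Complex.mul_re,
      Complex.I_re, Complex.I_im, Complex.ofReal_im]
    ring
  · filter_upwards [hgu] with s hs using hs.symm
  · simp only [div_eq_mul_inv]
    exact husm.mul (hν.inv fun x hx => hν0 x hx)
  · intro s hs
    simp [hB s hs, hB0]
  · intro s t hs hsr ht ht1
    have hts : 0 < t * s := mul_pos ht hs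
    have htss : t * s ≤ s := by nlinarith
    have h1 : μ s = μ (t * s) * ((s / (t * s) : ℝ) : ℂ) ^ ζ' :=
      expPrimitive_of_eq_div hA.continuousOn hts htss fun x hx =>
        hA2 x (hts.trans_le hx.1) (hx.2.trans hsr.le)
    have htc : (t : ℂ) ≠ 0 := Complex.ofReal_ne_zero.2 ht.ne'
    have hsc : (s : ℂ) ≠ 0 := Complex.ofReal_ne_zero.2 hs.ne'
    have h2 : s / (t * s) = t⁻¹ := by field_simp
    have h3 : ((t⁻¹ : ℝ) : ℂ) ^ ζ' = ((t : ℂ) ^ ζ')⁻¹ := by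
      rw [Complex.ofReal_inv, Complex.inv_cpow]
      rw [Complex.arg_ofReal_of_nonneg ht.le]
      exact Real.pi_pos.ne
    have h4 : (t : ℂ) ^ ζ' ≠ 0 := by rw [Complex.cpow_def_of_ne_zero htc]; exact Complex.exp_ne_zero _
    rw [h2, h3] at h1
    have h5 : μ (t * s) ≠ 0 := expPrimitive_ne_zero _ _
    simp only [hνdef]
    rw [hB₀ s ⟨hs, hsr⟩, hB₀ (t * s) ⟨hts, htss.trans_lt hsr⟩, h1, Complex.cpow_sub _ _ htc,
      Complex.cpow_neg]
    push_cast
    have h6 : (t : ℂ) ^ (2 : ℂ) = (t : ℂ) ^ 2 := Complex.cpow_ofNat _ _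
    rw [h6]
    field_simp

end VortexData

/-! ### Assembly of the regularity statement. -/

theorem mainTheorem7 (P : VortexData) (hP : P.Admissible)
    (a b : ℝ) (ha : 0 < a) (ha' : a ≤ 1) (hb : 0 < b) (hb' : b ≤ 1)
    (n : ℕ) (hn : 2 ≤ n) (lam : ℂ) (hlam : 3 * b < lam.re)
    (j : ℤ) (hj : j ≠ 0) (W : ℂ → ℂ) (hW : W ∈ P.kerLb a b n lam ∩ U (j * n)) :
    2 ≤ lam.re / b - a ∧
    ∃ W' : ℂ → ℂ, W' =ᵐ[volume] W ∧
      ContDiffOn ℝ ∞ W' {0}ᶜ ∧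
      HasCompactSupport W' ∧
      IsHolderClass (lam.re / b - a) W' := by
  have hγ : 2 < lam.re / b - a := by
    have : 3 < lam.re / b := by rw [lt_div_iff₀ hb]; exact hlam
    linarith
  refine ⟨hγ.le, ?_⟩
  obtain ⟨⟨-, D, -, hD, hE⟩, hL, g, hg⟩ := hW
  have hk : 2 ≤ (j * (n : ℤ)).natAbs := by
    rw [Int.natAbs_mul, Int.natAbs_natCast]
    have : 1 ≤ j.natAbs := Int.natAbs_pos.2 hj
    nlinarith
  have hk0 : j * (n : ℤ) ≠ 0 := by
    intro h
    rw [h] at hk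
    simp at hk
  obtain ⟨G, z, hz, hGg, hGs, hGout, hGin⟩ :=
    hP.exists_profile hb hk (by linarith) hL hg hD hE
  have hpunct : PunctHomog z (modeFun G (j * n)) := by
    refine ⟨fun X hX => ?_, hasCompactSupport_modeFun _ hGout, P.r₁ - P.ε, by linarith [hP.ε_lt_r₁], ?_⟩
    · exact (contDiffAt_modeFun _ hX (hGs.contDiffAt (Ioi_mem_nhds (norm_pos_iff.2 hX)))).contDiffWithinAt
    · intro X hX hXr t ht ht1
      have htc : (t : ℂ) ≠ 0 := Complex.ofReal_ne_zero.2 ht.ne'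
      have e : (t : ℂ) * X / ((t * ‖X‖ : ℝ) : ℂ) = X / ‖X‖ := by
        push_cast
        rw [mul_div_mul_left _ _ htc]
      rw [modeFun, modeFun, norm_smul, Real.norm_of_nonneg ht.le,
        hGin _ _ (norm_pos_iff.2 hX) hXr ht ht1, Complex.real_smul, e, smul_eq_mul, mul_assoc]
  refine ⟨modeFun G (j * n), ?_, hpunct.smooth, hpunct.compact, ?_⟩
  · filter_upwards [hg, ae_radial hGg] with X hX hX'
    rw [modeFun, hX, hX']
  · rw [← hz]
    refine hpunct.isHolderClass ?_ (by linarith)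
    -- At the origin the phase is `(0 / 0)^k = 0`, because `k ≠ 0`, whatever the value of `G` there.
    simp [modeFun, zero_zpow _ hk0]
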